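/- For complex sequences $\alpha,\beta$ on $\mathbb Z$ write $f^\pm(n)=f(n\pm1)$. Define homogeneous coefficients by $\hat f_{0,+}=-\alpha^+$, $\hat g_{0,+}=\tfrac12$, $\hat h_{0,+}=\beta$ and, for $\ell\ge0$, $$\hat g_{\ell+1,+}=\sum_{k=0}^{\ell}\hat f_{\ell-k,+}\hat h_{k,+}-\sum_{k=1}^{\ell}\hat g_{\ell+1-k,+}\hat g_{k,+},\quad \hat f_{\ell+1,+}^-=\hat f_{\ell,+}-\alpha(\hat g_{\ell+1,+}+\hat g_{\ell+1,+}^-),\quad \hat h_{\ell+1,+}=\hat h_{\ell,+}^-+\beta(\hat g_{\ell+1,+}+\hat g_{\ell+1,+}^-),$$ and by $\hat f_{0,-}=\alpha$, $\hat g_{0,-}=\tfrac12$, $\hat h_{0,-}=-\beta^+$ and $$\hat g_{\ell+1,-}=\sum_{k=0}^{\ell}\hat f_{\ell-k,-}\hat h_{k,-}-\sum_{k=1}^{\ell}\hat g_{\ell+1-k,-}\hat g_{k,-},\quad \hat f_{\ell+1,-}=\hat f_{\ell,-}^-+\alpha(\hat g_{\ell+1,-}+\hat g_{\ell+1,-}^-),\quad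 \hat h_{\ell+1,-}^-=\hat h_{\ell,-}-\beta(\hat g_{\ell+1,-}+\hat g_{\ell+1,-}^-).$$ For summation constants $c_{j,\pm}\in\mathbb C$ put $f_{\ell,\pm}=\sum_{k=0}^{\ell}c_{\ell-k,\pm}\hat f_{k,\pm}$, likewise $g_{\ell,\pm}$, $h_{\ell,\pm}$, and $f_{-1,\pm}=h_{-1,\pm}=0$. For $\underline r=(r_-,r_+)\in\mathbb N_0^2$ the equation $\mathrm{AL}_{\underline r}(\alpha,\beta)=0$ of the Ablowitz–Ladik hierarchy is the system $$-i\alpha_t-\alpha(g_{r_+,+}+g_{r_-,-}^-)+f_{r_+-1,+}-f_{r_--1,-}^-=0,\qquad -i\beta_t+\beta(g_{r_+,+}^-+g_{r_-,-})-h_{r_--1,-}+h_{r_+-1,+}^-=0$$ for $\alpha=\alpha(n,t)$, $\beta=\beta(n,t)$. A solution on $(-T,T)$ means one that is differentiable in $t$ for every $n$ and bounded in $n$, locally uniformly in $t\in(-T,T)$. Put $c_{\underline r}=(c_{r_-,-}+c_{r_+,+})/2$. For a weight $w$ let $$\|(a,b)\|_{w,p}=\Big(\sum_{n\in\mathbb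 Z}w(n)\big(|a(n)|^p+|b(n)|^p\big)\Big)^{1/p}\ (1\le p<\infty),\qquad \|(a,b)\|_{w,\infty}=\sup_{n\in\mathbb Z}w(n)\big(|a(n)|+|b(n)|\big).$$ **Theorem 3.3.** Let $\underline r=(r_-,r_+)\in\mathbb N_0^2\setminus\{(0,0)\}$ and let $c_{j,\pm}\in\mathbb C$, $0\le j\le r_\pm$, satisfy $$\sum_{j=0}^{r_+-1}c_{j,+}+\sum_{j=0}^{r_--1}c_{j,-}=0.$$ Let $w(n)\ge1$ be a weight with $\sup_n\big(|\tfrac{w(n+1)}{w(n)}|+|\tfrac{w(n)}{w(n+1)}|\big)<\infty$. Fix $1\le p\le\infty$ and let $\alpha_0,\beta_0,\tilde\alpha_0,\tilde\beta_0$ be bounded sequences such that - if $1\le p<\infty$: $\|(\alpha_0,\beta_0)\|_{w,2p}<\infty$, $\|(\alpha_0-\alpha_0^+,\beta_0-\beta_0^+)\|_{w,p}<\infty$, $\|(\tilde\alpha_0,\tilde\beta_0)\|_{w,p}<\infty$; - if $p=\infty$: $\|(\alpha_0,\beta_0)\|_{w,\infty}<\infty$, $\|(\alpha_0-\alpha_0^+,\beta_0-\beta_0^+)\|_{w^2,\infty}<\infty$,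 $\|(\tilde\alpha_0,\tilde\beta_0)\|_{w^2,\infty}<\infty$. Then for some $T>0$ there is a solution $(\alpha(t),\beta(t))$, $t\in(-T,T)$, of $\mathrm{AL}_{\underline r}(\alpha,\beta)=0$ with $\alpha(0)=\alpha_0+\tilde\alpha_0$, $\beta(0)=\beta_0+\tilde\beta_0$. For every $T>0$, a solution on $(-T,T)$ with these initial values is unique, and for all $t\in(-T,T)$ it is of the form $$\alpha(t)=e^{ic_{\underline r}t}\big(\alpha_0+\tilde\alpha(t)\big),\qquad \beta(t)=e^{-ic_{\underline r}t}\big(\beta_0+\tilde\beta(t)\big),$$ where $\|(\tilde\alpha(t),\tilde\beta(t))\|_{w,p}<\infty$ if $p<\infty$, respectively $\|(\tilde\alpha(t),\tilde\beta(t))\|_{w^2,\infty}<\infty$ if $p=\infty$. In particular, under the normalization $c_{\underline r}=0$ one has $\alpha(t)=\alpha_0+\tilde\alpha(t)$, $\beta(t)=\beta_0+\tilde\beta(t)$. -/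

import Mathlib

open scoped ENNReal

namespace AblowitzLadik

/-- A triple of complex sequences `f(n), g(n), h(n)`, `n ∈ ℤ`: one level of the coefficients
in the Laurent polynomials that generate the Ablowitz–Ladik hierarchy. -/
@[ext]
structure Coeff where
  f : ℤ → ℂ
  g : ℤ → ℂ
  h : ℤ → ℂ

/-- Homogeneous coefficients with subscript `+` of the pair `(a, b)` (i.e. `c₀ = 1` and all other
summation constants vanish):
`f₀ = -a⁺`, `g₀ = 1/2`, `h₀ = b`, and
`g_{ℓ+1} = ∑_{k=0}^{ℓ} f_{ℓ-k} h_k - ∑_{k=1}^{ℓ} g_{ℓ+1-k} g_k`,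
`f_{ℓ+1}⁻ = f_ℓ - a (g_{ℓ+1} + g_{ℓ+1}⁻)`,
`h_{ℓ+1} = h_ℓ⁻ + b (g_{ℓ+1} + g_{ℓ+1}⁻)`. -/
noncomputable def hatPlus (a b : ℤ → ℂ) : ℕ → Coeff
  | 0 => ⟨fun n => -a (n + 1), fun _ => 1 / 2, fun n => b n⟩
  | l + 1 =>
    let g : ℤ → ℂ := fun n =>
      (∑ k : Fin (l + 1), (hatPlus a b (l - k)).f n * (hatPlus a b k).h n)
        - ∑ k : Fin l, (hatPlus a b (l - k)).g n * (hatPlus a b (k + 1)).g n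
    ⟨fun n => (hatPlus a b l).f (n + 1) - a (n + 1) * (g (n + 1) + g n),
      g,
      fun n => (hatPlus a b l).h (n - 1) + b n * (g n + g (n - 1))⟩

/-- Homogeneous coefficients with subscript `-` of the pair `(a, b)`:
`f₀ = a`, `g₀ = 1/2`, `h₀ = -b⁺`, and
`g_{ℓ+1} = ∑_{k=0}^{ℓ} f_{ℓ-k} h_k - ∑_{k=1}^{ℓ} g_{ℓ+1-k} g_k`,
`f_{ℓ+1} = f_ℓ⁻ + a (g_{ℓ+1} + g_{ℓ+1}⁻)`,
`h_{ℓ+1}⁻ = h_ℓ - b (g_{ℓ+1} + g_{ℓ+1}⁻)`. -/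
noncomputable def hatMinus (a b : ℤ → ℂ) : ℕ → Coeff
  | 0 => ⟨fun n => a n, fun _ => 1 / 2, fun n => -b (n + 1)⟩
  | l + 1 =>
    let g : ℤ → ℂ := fun n =>
      (∑ k : Fin (l + 1), (hatMinus a b (l - k)).f n * (hatMinus a b k).h n)
        - ∑ k : Fin l, (hatMinus a b (l - k)).g n * (hatMinus a b (k + 1)).g n
    ⟨fun n => (hatMinus a b l).f (n - 1) + a n * (g n + g (n - 1)),
      g,
      fun n => (hatMinus a b l).h (n + 1) - b (n + 1) * (g (n + 1) + g n)⟩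

/-! The following facts show that the closed recursion above for `g` solves the difference
equations that determine `g` up to the summation constants. -/

theorem hatPlus_zero (a b : ℤ → ℂ) :
    hatPlus a b 0 = ⟨fun n => -a (n + 1), fun _ => 1 / 2, fun n => b n⟩ := by
  rw [hatPlus]

theorem hatPlus_g_succ (a b : ℤ → ℂ) (l : ℕ) (n : ℤ) :
    (hatPlus a b (l + 1)).g n =
      (∑ k ∈ Finset.range (l + 1), (hatPlus a b (l - k)).f n * (hatPlus a b k).h n)
        - ∑ k ∈ Finset.range l, (hatPlus a b (l - k)).g n * (hatPlus a b (k + 1)).g n := by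
  rw [hatPlus, Finset.sum_range, Finset.sum_range]

theorem hatPlus_f_succ (a b : ℤ → ℂ) (l : ℕ) (n : ℤ) :
    (hatPlus a b (l + 1)).f n = (hatPlus a b l).f (n + 1)
      - a (n + 1) * ((hatPlus a b (l + 1)).g (n + 1) + (hatPlus a b (l + 1)).g n) := by
  rw [hatPlus]

theorem hatPlus_h_succ (a b : ℤ → ℂ) (l : ℕ) (n : ℤ) :
    (hatPlus a b (l + 1)).h n = (hatPlus a b l).h (n - 1)
      + b n * ((hatPlus a b (l + 1)).g n + (hatPlus a b (l + 1)).g (n - 1)) := by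
  rw [hatPlus]

theorem hatMinus_zero (a b : ℤ → ℂ) :
    hatMinus a b 0 = ⟨fun n => a n, fun _ => 1 / 2, fun n => -b (n + 1)⟩ := by
  rw [hatMinus]

theorem hatMinus_g_succ (a b : ℤ → ℂ) (l : ℕ) (n : ℤ) :
    (hatMinus a b (l + 1)).g n =
      (∑ k ∈ Finset.range (l + 1), (hatMinus a b (l - k)).f n * (hatMinus a b k).h n)
        - ∑ k ∈ Finset.range l, (hatMinus a b (l - k)).g n * (hatMinus a b (k + 1)).g n := by
  rw [hatMinus, Finset.sum_range, Finset.sum_range]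

theorem hatMinus_f_succ (a b : ℤ → ℂ) (l : ℕ) (n : ℤ) :
    (hatMinus a b (l + 1)).f n = (hatMinus a b l).f (n - 1)
      + a n * ((hatMinus a b (l + 1)).g n + (hatMinus a b (l + 1)).g (n - 1)) := by
  rw [hatMinus]

theorem hatMinus_h_succ (a b : ℤ → ℂ) (l : ℕ) (n : ℤ) :
    (hatMinus a b (l + 1)).h n = (hatMinus a b l).h (n + 1)
      - b (n + 1) * ((hatMinus a b (l + 1)).g (n + 1) + (hatMinus a b (l + 1)).g n) := by
  rw [hatMinus]

theorem mk_g_sq (f g h : ℕ → ℂ) (h0 : g 0 = 1 / 2)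
    (hs : ∀ l, g (l + 1) = (∑ k ∈ Finset.range (l + 1), f (l - k) * h k)
      - ∑ k ∈ Finset.range l, g (l - k) * g (k + 1)) :
    PowerSeries.mk g * PowerSeries.mk g
      = PowerSeries.C (1 / 4) + PowerSeries.X * (PowerSeries.mk f * PowerSeries.mk h) := by
  ext l
  cases l with
  | zero => simp [PowerSeries.coeff_mul, h0]; norm_num
  | succ l =>
    have e1 : (PowerSeries.coeff (l + 1)) (PowerSeries.C (1 / 4 : ℂ)) = 0 := by
      rw [PowerSeries.coeff_C]; simp
    have e2 : ∑ k ∈ Finset.range (l + 1), f (l - k) * h k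
        = ∑ k ∈ Finset.range (l + 1), f k * h (l - k) := by
      rw [← Finset.sum_range_reflect]
      refine Finset.sum_congr rfl fun k hk => ?_
      have hk' := Finset.mem_range.1 hk
      rw [show l - (l + 1 - 1 - k) = k by omega, show l + 1 - 1 - k = l - k by omega]
    have e3 : ∑ k ∈ Finset.range l, g (l + 1 - (k + 1)) * g (k + 1)
        = ∑ k ∈ Finset.range l, g (l - k) * g (k + 1) :=
      Finset.sum_congr rfl fun k _ => by rw [Nat.add_sub_add_right]
    have e4 : ∑ k ∈ Finset.range l, g (k + 1) * g (l + 1 - (k + 1))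
        = ∑ k ∈ Finset.range l, g (l - k) * g (k + 1) :=
      Finset.sum_congr rfl fun k _ => by rw [Nat.add_sub_add_right, mul_comm]
    have hl := hs l
    rw [map_add, PowerSeries.coeff_succ_X_mul, PowerSeries.coeff_mul, PowerSeries.coeff_mul, e1,
      zero_add]
    simp only [PowerSeries.coeff_mk]
    rw [Finset.Nat.sum_antidiagonal_eq_sum_range_succ (fun i j => g i * g j),
      Finset.Nat.sum_antidiagonal_eq_sum_range_succ (fun i j => f i * h j),
      Finset.sum_range_succ, Finset.sum_range_succ', e4, ← e2]
    simp only [Nat.sub_self, Nat.sub_zero, h0]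
    linear_combination hl

theorem mk_g_sub {F F' G G' H H' : PowerSeries ℂ} {a b : ℂ}
    (hG : G * G = PowerSeries.C (1 / 4) + PowerSeries.X * (F * H))
    (hG' : G' * G' = PowerSeries.C (1 / 4) + PowerSeries.X * (F' * H'))
    (hF : F' = PowerSeries.X * F - PowerSeries.C a * (G + G'))
    (hH : H = PowerSeries.X * H' + PowerSeries.C b * (G + G'))
    (hS : PowerSeries.coeff 0 (G + G') = 1) :
    G - G' = PowerSeries.X * (PowerSeries.C a * H' + PowerSeries.C b * F) := by
  have hS' : G + G' ≠ 0 := by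
    intro h
    rw [h] at hS
    simp at hS
  apply mul_right_cancel₀ hS'
  subst hF
  subst hH
  linear_combination hG - hG'

/-- `ĝ_{ℓ+1,+} - ĝ_{ℓ+1,+}⁻ = a ĥ_{ℓ,+}⁻ + b f̂_{ℓ,+}`. -/
theorem hatPlus_g_sub (a b : ℤ → ℂ) (l : ℕ) (n : ℤ) :
    (hatPlus a b (l + 1)).g n - (hatPlus a b (l + 1)).g (n - 1)
      = a n * (hatPlus a b l).h (n - 1) + b n * (hatPlus a b l).f n := by
  have hG := fun m => mk_g_sq (fun l => (hatPlus a b l).f m) (fun l => (hatPlus a b l).g m)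
    (fun l => (hatPlus a b l).h m) (by rw [hatPlus_zero]) (fun l => hatPlus_g_succ a b l m)
  have key := mk_g_sub (a := a n) (b := b n) (hG n) (hG (n - 1))
    (by
      ext l
      cases l with
      | zero => simp [hatPlus_zero]; norm_num
      | succ l =>
        rw [map_sub, PowerSeries.coeff_succ_X_mul]
        simp [PowerSeries.coeff_C_mul, hatPlus_f_succ])
    (by
      ext l
      cases l with
      | zero => simp [hatPlus_zero]; norm_num
      | succ l =>
        rw [map_add, PowerSeries.coeff_succ_X_mul]
        simp [PowerSeries.coeff_C_mul, hatPlus_h_succ])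
    (by simp [hatPlus_zero]; norm_num)
  have := congrArg (PowerSeries.coeff (l + 1)) key
  rw [PowerSeries.coeff_succ_X_mul] at this
  simpa using this

/-- `ĝ_{ℓ+1,-} - ĝ_{ℓ+1,-}⁻ = a ĥ_{ℓ,-} + b f̂_{ℓ,-}⁻`. -/
theorem hatMinus_g_sub (a b : ℤ → ℂ) (l : ℕ) (n : ℤ) :
    (hatMinus a b (l + 1)).g n - (hatMinus a b (l + 1)).g (n - 1)
      = a n * (hatMinus a b l).h n + b n * (hatMinus a b l).f (n - 1) := by
  have hG := fun m => mk_g_sq (fun l => (hatMinus a b l).f m) (fun l => (hatMinus a b l).g m)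
    (fun l => (hatMinus a b l).h m) (by rw [hatMinus_zero]) (fun l => hatMinus_g_succ a b l m)
  have key := mk_g_sub (a := b n) (b := a n)
    (F := PowerSeries.mk fun l => (hatMinus a b l).h n)
    (H := PowerSeries.mk fun l => (hatMinus a b l).f n)
    (F' := PowerSeries.mk fun l => (hatMinus a b l).h (n - 1))
    (H' := PowerSeries.mk fun l => (hatMinus a b l).f (n - 1))
    ((hG n).trans (by rw [mul_comm (PowerSeries.mk fun l => (hatMinus a b l).f n)]))
    ((hG (n - 1)).trans (by rw [mul_comm (PowerSeries.mk fun l => (hatMinus a b l).f (n - 1))]))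
    (by
      ext l
      cases l with
      | zero => simp [hatMinus_zero]; norm_num
      | succ l =>
        rw [map_sub, PowerSeries.coeff_succ_X_mul]
        simp [PowerSeries.coeff_C_mul, hatMinus_h_succ])
    (by
      ext l
      cases l with
      | zero => simp [hatMinus_zero]; norm_num
      | succ l =>
        rw [map_add, PowerSeries.coeff_succ_X_mul]
        simp [PowerSeries.coeff_C_mul, hatMinus_f_succ])
    (by simp [hatMinus_zero]; norm_num)
  have := congrArg (PowerSeries.coeff (l + 1)) key
  rw [PowerSeries.coeff_succ_X_mul] at this
  simp only [map_sub, map_add, PowerSeries.coeff_mk, PowerSeries.coeff_C_mul] at this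
  linear_combination this

/-- Passage from the homogeneous coefficients to those with summation constants `c₀, c₁, …`:
`f_ℓ = ∑_{k=0}^{ℓ} c_{ℓ-k} f̂_k`, and likewise for `g` and `h`. -/
noncomputable def withConstants (c : ℕ → ℂ) (X : ℕ → Coeff) (l : ℕ) : Coeff where
  f n := ∑ k ∈ Finset.range (l + 1), c (l - k) * (X k).f n
  g n := ∑ k ∈ Finset.range (l + 1), c (l - k) * (X k).g n
  h n := ∑ k ∈ Finset.range (l + 1), c (l - k) * (X k).h n

/-- The coefficients `f_{ℓ,+}, g_{ℓ,+}, h_{ℓ,+}` with summation constants `c_{j,+} = c j`. -/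
noncomputable def coeffPlus (a b : ℤ → ℂ) (c : ℕ → ℂ) : ℕ → Coeff :=
  withConstants c (hatPlus a b)

/-- The coefficients `f_{ℓ,-}, g_{ℓ,-}, h_{ℓ,-}` with summation constants `c_{j,-} = c j`. -/
noncomputable def coeffMinus (a b : ℤ → ℂ) (c : ℕ → ℂ) : ℕ → Coeff :=
  withConstants c (hatMinus a b)

/-- The level `r - 1`, with the convention that level `-1` vanishes identically. -/
noncomputable def levelBelow (X : ℕ → Coeff) : ℕ → Coeff
  | 0 => ⟨fun _ => 0, fun _ => 0, fun _ => 0⟩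
  | l + 1 => X l

/-- `(α, β)` solves the equation `AL_r(α, β) = 0`, `r = (r₋, r₊)`, with summation constants
`c_{j,-} = cm j` (`0 ≤ j ≤ r₋`) and `c_{j,+} = cp j` (`0 ≤ j ≤ r₊`), on the time interval `(-T, T)`.
Here `α t n` stands for `α(n, t)`. The sequences are bounded in `n`, locally uniformly in
`t ∈ (-T, T)`, differentiable in `t`, and satisfy both components of the equation. -/
structure IsSolution (rm rp : ℕ) (cm cp : ℕ → ℂ) (T : ℝ) (α β : ℝ → ℤ → ℂ) : Prop where
  bounded : ∀ S < T, ∃ C : ℝ, ∀ t : ℝ, |t| ≤ S → ∀ n : ℤ, ‖α t n‖ ≤ C ∧ ‖β t n‖ ≤ C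
  diff_fst : ∀ t ∈ Set.Ioo (-T) T, ∀ n : ℤ, DifferentiableAt ℝ (fun s => α s n) t
  diff_snd : ∀ t ∈ Set.Ioo (-T) T, ∀ n : ℤ, DifferentiableAt ℝ (fun s => β s n) t
  eq_fst : ∀ t ∈ Set.Ioo (-T) T, ∀ n : ℤ,
    -Complex.I * deriv (fun s => α s n) t
      - α t n * ((coeffPlus (α t) (β t) cp rp).g n + (coeffMinus (α t) (β t) cm rm).g (n - 1))
      + (levelBelow (coeffPlus (α t) (β t) cp) rp).f n
      - (levelBelow (coeffMinus (α t) (β t) cm) rm).f (n - 1) = 0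
  eq_snd : ∀ t ∈ Set.Ioo (-T) T, ∀ n : ℤ,
    -Complex.I * deriv (fun s => β s n) t
      + β t n * ((coeffPlus (α t) (β t) cp rp).g (n - 1) + (coeffMinus (α t) (β t) cm rm).g n)
      - (levelBelow (coeffMinus (α t) (β t) cm) rm).h n
      + (levelBelow (coeffPlus (α t) (β t) cp) rp).h (n - 1) = 0

/-- The constant `c_r = (c_{r₋,-} + c_{r₊,+}) / 2`. -/
noncomputable def topConstant (rm rp : ℕ) (cm cp : ℕ → ℂ) : ℂ := (cm rm + cp rp) / 2

/-- The weighted norm `‖(a, b)‖_{w,p}`, `1 ≤ p ≤ ∞`, with values in `[0, ∞]` (for weights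
`w ≥ 0`): `(∑ₙ w(n) (|a(n)|^p + |b(n)|^p))^{1/p}` if `p < ∞`, `supₙ w(n) (|a(n)| + |b(n)|)`
if `p = ∞`. -/
noncomputable def wnorm (w : ℤ → ℝ) (p : ℝ≥0∞) (a b : ℤ → ℂ) : ℝ≥0∞ :=
  if p = ∞ then ⨆ n : ℤ, ENNReal.ofReal (w n * (‖a n‖ + ‖b n‖))
  else (∑' n : ℤ, ENNReal.ofReal (w n * (‖a n‖ ^ p.toReal + ‖b n‖ ^ p.toReal))) ^ (1 / p.toReal)

/-- `a` is a bounded sequence. -/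
def IsBoundedSeq (a : ℤ → ℂ) : Prop := ∃ C : ℝ, ∀ n : ℤ, ‖a n‖ ≤ C

end AblowitzLadik

/-!
A solution of the system is a curve in the space of pairs of bounded sequences, driven by a vector
field whose components are polynomials in finitely many shifts of `α` and `β` (`LocalPoly`). Such
polynomials are bounded and Lipschitz on balls of the supremum norm, so local existence is the
Picard–Lindelöf theorem in that space (`exists_isSolution`), and uniqueness is Gronwall's inequality
(`IsSolution.eq_of_initial_eq`).

For the form of the solution, the coefficients `f̂_ℓ` and `ĥ_ℓ` are single shifts of `α` or `β` plus
terms of order at least two, and `ĝ_ℓ` is a constant plus terms of order at least two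
(`localPoly_hatPlus`). The condition on the summation constants makes the linear part of the vector
field equal to `i c_r α` plus differences of shifts of `α` (`localPoly_velocity`). The first summand
is removed by the factor `exp(-i c_r t)`. Evaluated at the background `(α₀, β₀)`, the rest involves
only differences of `α₀`, `β₀` and products of at least two of their shifts, all of which lie in the
weighted space.

That this space is preserved in time is shown by a pointwise comparison. The differences and squares
of the background and the initial perturbation have a common majorant `E` in the weighted space with
bounded ratios `E(n ± 1) / E(n)` (`WeightedMem.exists_slowlyVarying`). Since the vector field only
couples sites at a bounded distance, the perturbation obeys a linear growth estimate in the supremum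
norm with weight `1 / (E + ε)`, uniformly in `ε > 0`; so by Gronwall's inequality
(`norm_le_of_linear_growth`) it stays below a multiple of `E` (`IsSolution.exists_perturbation_le`).
-/

namespace AblowitzLadik

/-! ### Differential-difference polynomials -/

/-- `LocalPoly d Φ`: the functional `Φ`, mapping a pair of sequences `(a, b)` to a sequence, is a
polynomial with constant coefficients in finitely many shifts of `a` and `b`, all of whose monomials
have degree at least `d`. -/
inductive LocalPoly : ℕ → ((ℤ → ℂ) → (ℤ → ℂ) → ℤ → ℂ) → Prop
  | const (c : ℂ) : LocalPoly 0 fun _ _ _ => c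
  | fst (j : ℤ) : LocalPoly 1 fun a _ n => a (n + j)
  | snd (j : ℤ) : LocalPoly 1 fun _ b n => b (n + j)
  | zero (d : ℕ) : LocalPoly d fun _ _ _ => 0
  | add {d : ℕ} {Φ Ψ : (ℤ → ℂ) → (ℤ → ℂ) → ℤ → ℂ} : LocalPoly d Φ → LocalPoly d Ψ →
      LocalPoly d fun a b n => Φ a b n + Ψ a b n
  | mul {d e : ℕ} {Φ Ψ : (ℤ → ℂ) → (ℤ → ℂ) → ℤ → ℂ} : LocalPoly d Φ → LocalPoly e Ψ →
      LocalPoly (d + e) fun a b n => Φ a b n * Ψ a b n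
  | weaken {d e : ℕ} {Φ : (ℤ → ℂ) → (ℤ → ℂ) → ℤ → ℂ} : e ≤ d → LocalPoly d Φ → LocalPoly e Φ

namespace LocalPoly

variable {d : ℕ} {Φ Ψ : (ℤ → ℂ) → (ℤ → ℂ) → ℤ → ℂ}

theorem const_mul (c : ℂ) (h : LocalPoly d Φ) : LocalPoly d fun a b n => c * Φ a b n := by
  simpa using (LocalPoly.const c).mul h

theorem neg (h : LocalPoly d Φ) : LocalPoly d fun a b n => -Φ a b n := by
  simpa using h.const_mul (-1)

theorem sub (h : LocalPoly d Φ) (h' : LocalPoly d Ψ) :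
    LocalPoly d fun a b n => Φ a b n - Ψ a b n := by
  simpa [sub_eq_add_neg] using h.add h'.neg

theorem sum {ι : Type*} (s : Finset ι) {Φ : ι → (ℤ → ℂ) → (ℤ → ℂ) → ℤ → ℂ}
    (h : ∀ k ∈ s, LocalPoly d (Φ k)) : LocalPoly d fun a b n => ∑ k ∈ s, Φ k a b n := by
  classical
  induction s using Finset.induction_on with
  | empty => simpa using LocalPoly.zero d
  | insert i s hi ih =>
    simp only [Finset.sum_insert hi]
    exact (h i (by simp)).add (ih fun k hk => h k (by simp [hk]))

theorem shift (h : LocalPoly d Φ) (j : ℤ) : LocalPoly d fun a b n => Φ a b (n + j) := by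
  induction h with
  | const c => exact .const c
  | fst i => simpa [add_assoc] using LocalPoly.fst (j + i)
  | snd i => simpa [add_assoc] using LocalPoly.snd (j + i)
  | zero d => exact .zero d
  | add _ _ h h' => exact h.add h'
  | mul _ _ h h' => exact h.mul h'
  | weaken he _ h => exact h.weaken he

theorem swap (h : LocalPoly d Φ) : LocalPoly d fun a b n => Φ b a n := by
  induction h with
  | const c => exact .const c
  | fst i => exact .snd i
  | snd i => exact .fst i
  | zero d => exact .zero d
  | add _ _ h h' => exact h.add h'
  | mul _ _ h h' => exact h.mul h'
  | weaken he _ h => exact h.weaken he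

end LocalPoly

/-- The sequence `q` changes by at most the factor `ρ` between neighbours. -/
def SlowlyVarying (ρ : ℝ) (q : ℤ → ℝ) : Prop :=
  ∀ n, q (n + 1) ≤ ρ * q n ∧ q n ≤ ρ * q (n + 1)

namespace SlowlyVarying

variable {ρ : ℝ} {q : ℤ → ℝ}

theorem shift_le (h : SlowlyVarying ρ q) (hρ : 0 ≤ ρ) (j n : ℤ) :
    q (n + j) ≤ ρ ^ j.natAbs * q n := by
  have hpos : ∀ (k : ℕ) (n : ℤ), q (n + k) ≤ ρ ^ k * q n := by
    intro k
    induction k with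
    | zero => simp
    | succ k ih =>
      intro n
      have h1 := (h (n + k)).1
      have h2 := mul_le_mul_of_nonneg_left (ih n) hρ
      rw [Nat.cast_succ, ← add_assoc, pow_succ']
      linarith
  have hneg : ∀ (k : ℕ) (n : ℤ), q (n - k) ≤ ρ ^ k * q n := by
    intro k
    induction k with
    | zero => simp
    | succ k ih =>
      intro n
      have h1 := (h (n - (k + 1))).2
      rw [show n - ((k : ℤ) + 1) + 1 = n - k by ring] at h1
      have h2 := mul_le_mul_of_nonneg_left (ih n) hρ
      rw [Nat.cast_succ, pow_succ']
      linarith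
  obtain ⟨k, rfl | rfl⟩ := j.eq_nat_or_neg
  · simpa using hpos k n
  · simpa [← sub_eq_add_neg] using hneg k n

theorem const_mul (h : SlowlyVarying ρ q) {c : ℝ} (hc : 0 ≤ c) :
    SlowlyVarying ρ fun n => c * q n := fun n =>
  ⟨by nlinarith [mul_le_mul_of_nonneg_left (h n).1 hc],
    by nlinarith [mul_le_mul_of_nonneg_left (h n).2 hc]⟩

theorem add_const (h : SlowlyVarying ρ q) (hρ : 1 ≤ ρ) {c : ℝ} (hc : 0 ≤ c) :
    SlowlyVarying ρ fun n => q n + c := fun n =>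
  ⟨by nlinarith [(h n).1], by nlinarith [(h n).2]⟩

theorem min_sqrt (h : SlowlyVarying ρ q) (hρ : 1 ≤ ρ) {B : ℝ} (hB : 0 ≤ B) :
    SlowlyVarying ρ fun n => min B √(q n) := by
  have key : ∀ x y : ℝ, x ≤ ρ * y → min B √x ≤ ρ * min B √y := by
    intro x y hxy
    have h1 : √x ≤ ρ * √y := by
      refine (Real.sqrt_le_sqrt hxy).trans ?_
      rw [Real.sqrt_mul (by linarith)]
      have : √ρ ≤ ρ := by
        rw [Real.sqrt_le_left (by linarith)]
        nlinarith
      exact mul_le_mul_of_nonneg_right this (Real.sqrt_nonneg _)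
    rw [mul_min_of_nonneg _ _ (by linarith)]
    exact min_le_min (by nlinarith) h1
  exact fun n => ⟨key _ _ (h n).1, key _ _ (h n).2⟩

theorem norm_shift_sub_le (h : SlowlyVarying ρ q) (hρ : 1 ≤ ρ) {x : ℤ → ℂ}
    (hx : ∀ n, ‖x (n + 1) - x n‖ ≤ q n) (j n : ℤ) :
    ‖x (n + j) - x n‖ ≤ j.natAbs * ρ ^ j.natAbs * q n := by
  have hρ0 : 0 ≤ ρ := by linarith
  have hq : ∀ n, 0 ≤ q n := fun n => (norm_nonneg _).trans (hx n)
  have mono : ∀ (k : ℕ) (n : ℤ), ρ ^ k * q n ≤ ρ ^ (k + 1) * q n := fun k n =>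
    mul_le_mul_of_nonneg_right (pow_le_pow_right₀ hρ (Nat.le_succ k)) (hq n)
  have step : ∀ (k : ℕ) (n : ℤ), k * (ρ ^ k * q n) ≤ k * (ρ ^ (k + 1) * q n) := fun k n =>
    mul_le_mul_of_nonneg_left (mono k n) (Nat.cast_nonneg k)
  have hpos : ∀ (k : ℕ) (n : ℤ), ‖x (n + k) - x n‖ ≤ k * ρ ^ k * q n := by
    intro k n
    induction k with
    | zero => simp
    | succ k ih =>
      have h1 := (hx (n + k)).trans (h.shift_le hρ0 k n)
      have h2 := norm_add_le (x (n + k + 1) - x (n + k)) (x (n + k) - x n)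
      rw [sub_add_sub_cancel] at h2
      rw [Int.natAbs_natCast] at h1
      push_cast
      rw [← add_assoc]
      nlinarith [mono k n, step k n]
  have hneg : ∀ (k : ℕ) (n : ℤ), ‖x (n - k) - x n‖ ≤ k * ρ ^ k * q n := by
    intro k n
    induction k with
    | zero => simp
    | succ k ih =>
      have h1 := (hx (n + -((k + 1 : ℕ) : ℤ))).trans (h.shift_le hρ0 _ n)
      rw [Int.natAbs_neg, Int.natAbs_natCast,
        show n + -((k + 1 : ℕ) : ℤ) + 1 = n - k by push_cast; ring, norm_sub_rev,
        ← sub_eq_add_neg] at h1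
      have h2 := norm_add_le (x (n - (k + 1 : ℕ)) - x (n - k)) (x (n - k) - x n)
      rw [sub_add_sub_cancel] at h2
      push_cast at h1 h2 ⊢
      nlinarith [mono k n, step k n]
  obtain ⟨k, rfl | rfl⟩ := j.eq_nat_or_neg
  · simpa using hpos k n
  · simpa [← sub_eq_add_neg] using hneg k n

end SlowlyVarying

/-- A polynomial in shifts of order `d` is bounded by the `d`-th power of any bounded slowly varying
majorant of its arguments. -/
theorem LocalPoly.exists_norm_le_pow {d : ℕ} {Φ : (ℤ → ℂ) → (ℤ → ℂ) → ℤ → ℂ} (h : LocalPoly d Φ)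
    {ρ : ℝ} (hρ : 0 ≤ ρ) (B : ℝ) :
    ∃ C, 0 ≤ C ∧ ∀ (a b : ℤ → ℂ) (q : ℤ → ℝ), SlowlyVarying ρ q → (∀ n, q n ≤ B) →
      (∀ n, ‖a n‖ ≤ q n) → (∀ n, ‖b n‖ ≤ q n) → ∀ n, ‖Φ a b n‖ ≤ C * q n ^ d := by
  induction h with
  | const c => exact ⟨‖c‖, norm_nonneg _, by intros; simp⟩
  | fst j =>
    exact ⟨ρ ^ j.natAbs, by positivity, fun a b q hq _ ha _ n => by
      simpa using (ha _).trans (hq.shift_le hρ j n)⟩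
  | snd j =>
    exact ⟨ρ ^ j.natAbs, by positivity, fun a b q hq _ _ hb n => by
      simpa using (hb _).trans (hq.shift_le hρ j n)⟩
  | zero d => exact ⟨0, le_rfl, by intros; simp⟩
  | add _ _ h h' =>
    obtain ⟨C, hC, h⟩ := h
    obtain ⟨C', hC', h'⟩ := h'
    refine ⟨C + C', by positivity, fun a b q hq hB ha hb n => ?_⟩
    rw [add_mul]
    exact norm_add_le_of_le (h a b q hq hB ha hb n) (h' a b q hq hB ha hb n)
  | @mul d e _ _ _ _ h h' =>
    obtain ⟨C, hC, h⟩ := h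
    obtain ⟨C', hC', h'⟩ := h'
    refine ⟨C * C', by positivity, fun a b q hq hB ha hb n => ?_⟩
    have hq0 : 0 ≤ q n := (norm_nonneg _).trans (ha n)
    rw [norm_mul, pow_add, mul_mul_mul_comm]
    exact mul_le_mul (h a b q hq hB ha hb n) (h' a b q hq hB ha hb n) (norm_nonneg _)
      (by positivity)
  | @weaken d e _ he _ h =>
    obtain ⟨C, hC, h⟩ := h
    refine ⟨C * |B| ^ (d - e), by positivity, fun a b q hq hB ha hb n => ?_⟩
    have hq0 : 0 ≤ q n := (norm_nonneg _).trans (ha n)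
    refine (h a b q hq hB ha hb n).trans ?_
    rw [mul_assoc]
    refine mul_le_mul_of_nonneg_left ?_ hC
    obtain ⟨k, rfl⟩ := Nat.exists_eq_add_of_le he
    rw [Nat.add_sub_cancel_left, pow_add, mul_comm]
    gcongr
    exact (hB n).trans (le_abs_self B)

theorem LocalPoly.exists_norm_le {d : ℕ} {Φ : (ℤ → ℂ) → (ℤ → ℂ) → ℤ → ℂ} (h : LocalPoly d Φ)
    (B : ℝ) : ∃ C, 0 ≤ C ∧ ∀ a b : ℤ → ℂ, (∀ n, ‖a n‖ ≤ B) → (∀ n, ‖b n‖ ≤ B) →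
      ∀ n, ‖Φ a b n‖ ≤ C := by
  obtain ⟨C, hC, h⟩ := h.exists_norm_le_pow zero_le_one B
  refine ⟨C * |B| ^ d, by positivity, fun a b ha hb n => ?_⟩
  have hB : B = |B| := (abs_of_nonneg ((norm_nonneg _).trans (ha 0))).symm
  rw [← hB]
  exact h a b (fun _ => B) (fun n => by simp) (fun _ => le_rfl) ha hb n

/-- A polynomial in shifts is Lipschitz on balls for the supremum norm. -/
theorem LocalPoly.exists_norm_sub_le {d : ℕ} {Φ : (ℤ → ℂ) → (ℤ → ℂ) → ℤ → ℂ} (h : LocalPoly d Φ)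
    (B : ℝ) : ∃ K, 0 ≤ K ∧ ∀ (a b a' b' : ℤ → ℂ) (δ : ℝ), (∀ n, ‖a n‖ ≤ B) → (∀ n, ‖b n‖ ≤ B) →
      (∀ n, ‖a' n‖ ≤ B) → (∀ n, ‖b' n‖ ≤ B) → (∀ n, ‖a n - a' n‖ ≤ δ) →
      (∀ n, ‖b n - b' n‖ ≤ δ) → ∀ n, ‖Φ a b n - Φ a' b' n‖ ≤ K * δ := by
  induction h with
  | const c =>
    exact ⟨0, le_rfl, by intros; simp⟩
  | fst j => exact ⟨1, zero_le_one, fun a b a' b' δ _ _ _ _ h _ n => by simpa using h (n + j)⟩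
  | snd j => exact ⟨1, zero_le_one, fun a b a' b' δ _ _ _ _ _ h n => by simpa using h (n + j)⟩
  | zero d => exact ⟨0, le_rfl, by intros; simp⟩
  | add _ _ h h' =>
    obtain ⟨K, hK, h⟩ := h
    obtain ⟨K', hK', h'⟩ := h'
    refine ⟨K + K', by positivity, fun a b a' b' δ ha hb ha' hb' h1 h2 n => ?_⟩
    rw [add_mul, add_sub_add_comm]
    exact norm_add_le_of_le (h a b a' b' δ ha hb ha' hb' h1 h2 n)
      (h' a b a' b' δ ha hb ha' hb' h1 h2 n)
  | @mul d e Φ Ψ hΦ hΨ h h' =>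
    obtain ⟨K, hK, h⟩ := h
    obtain ⟨K', hK', h'⟩ := h'
    obtain ⟨C, hC, hΦ⟩ := hΦ.exists_norm_le B
    obtain ⟨C', hC', hΨ⟩ := hΨ.exists_norm_le B
    refine ⟨K * C' + C * K', by positivity, fun a b a' b' δ ha hb ha' hb' h1 h2 n => ?_⟩
    have e : Φ a b n * Ψ a b n - Φ a' b' n * Ψ a' b' n
        = (Φ a b n - Φ a' b' n) * Ψ a b n + Φ a' b' n * (Ψ a b n - Ψ a' b' n) := by ring
    have hδ : 0 ≤ δ := (norm_nonneg _).trans (h1 0)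
    rw [e, show (K * C' + C * K') * δ = K * δ * C' + C * (K' * δ) by ring]
    refine norm_add_le_of_le ?_ ?_ <;> rw [norm_mul]
    · exact mul_le_mul (h a b a' b' δ ha hb ha' hb' h1 h2 n) (hΨ a b ha hb n) (norm_nonneg _)
        (by positivity)
    · exact mul_le_mul (hΦ a' b' ha' hb' n) (h' a b a' b' δ ha hb ha' hb' h1 h2 n)
        (norm_nonneg _) hC
  | weaken _ _ h => exact h

/-! ### The coefficients of the hierarchy -/

/-- `f̂_{ℓ,+}` and `ĥ_{ℓ,+}` are shifts of `-a` and `b`, and `ĝ_{ℓ,+}` is constant, up to terms of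
order two. -/
theorem localPoly_hatPlus (l : ℕ) :
    LocalPoly 2 (fun a b n => (hatPlus a b l).f n + a (n + (l + 1))) ∧
    LocalPoly 2 (fun a b n => (hatPlus a b l).g n - if l = 0 then 1 / 2 else 0) ∧
    LocalPoly 2 (fun a b n => (hatPlus a b l).h n - b (n - l)) := by
  induction l using Nat.strong_induction_on with
  | _ l ih =>
    cases l with
    | zero => refine ⟨?_, ?_, ?_⟩ <;> simpa [hatPlus_zero] using LocalPoly.zero 2
    | succ l =>
      have hf : ∀ k ≤ l, LocalPoly 1 fun a b n => (hatPlus a b k).f n := fun k hk => by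
        simpa using ((ih k (by omega)).1.weaken one_le_two).sub (.fst (k + 1))
      have hh : ∀ k ≤ l, LocalPoly 1 fun a b n => (hatPlus a b k).h n := fun k hk => by
        simpa [sub_eq_add_neg] using ((ih k (by omega)).2.2.weaken one_le_two).add (.snd (-k))
      have hg : ∀ k ≤ l, 0 < k → LocalPoly 1 fun a b n => (hatPlus a b k).g n := fun k hk h0 => by
        simpa [h0.ne'] using (ih k (by omega)).2.1.weaken one_le_two
      have G : LocalPoly 2 fun a b n => (hatPlus a b (l + 1)).g n := by
        have e : (fun a b n => (hatPlus a b (l + 1)).g n) = _ :=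
          funext fun a => funext fun b => funext fun n => hatPlus_g_succ a b l n
        rw [e]
        refine (LocalPoly.sum _ fun k hk => ?_).sub (LocalPoly.sum _ fun k hk => ?_)
        all_goals rw [Finset.mem_range] at hk
        · exact (hf _ (by omega)).mul (hh _ (by omega))
        · exact (hg _ (by omega) (by omega)).mul (hg _ (by omega) (by omega))
      refine ⟨?_, by simpa using G, ?_⟩
      · have h1 := (ih l (by omega)).1.shift 1
        have h2 : LocalPoly 2 _ := ((LocalPoly.fst 1).mul ((G.shift 1).add G)).weaken (by omega)
        convert h1.sub h2 using 4
        rename_i a b n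
        rw [hatPlus_f_succ, show n + (((l + 1 : ℕ) : ℤ) + 1) = n + 1 + (l + 1) by push_cast; ring]
        ring
      · have h1 := (ih l (by omega)).2.2.shift (-1)
        have h2 : LocalPoly 2 _ := ((LocalPoly.snd 0).mul (G.add (G.shift (-1)))).weaken (by omega)
        convert h1.add h2 using 4
        rename_i a b n
        rw [hatPlus_h_succ, show n - ((l + 1 : ℕ) : ℤ) = n + -1 - l by push_cast; ring]
        simp only [← sub_eq_add_neg, add_zero]
        ring

/-- The coefficients with subscript `-` arise from those with subscript `+` by exchanging the two
sequences and the roles of `f` and `h`. -/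
theorem hatMinus_eq (a b : ℤ → ℂ) (l : ℕ) :
    hatMinus a b l = ⟨(hatPlus b a l).h, (hatPlus b a l).g, (hatPlus b a l).f⟩ := by
  induction l using Nat.strong_induction_on with
  | _ l ih =>
    cases l with
    | zero => rw [hatMinus_zero, hatPlus_zero]
    | succ l =>
      have G : ∀ n, (hatMinus a b (l + 1)).g n = (hatPlus b a (l + 1)).g n := by
        intro n
        rw [hatMinus_g_succ, hatPlus_g_succ]
        congr 1
        · rw [← Finset.sum_range_reflect]
          refine Finset.sum_congr rfl fun k hk => ?_
          rw [Finset.mem_range] at hk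
          rw [show l - (l + 1 - 1 - k) = k by omega, show l + 1 - 1 - k = l - k by omega,
            ih k (by omega), ih (l - k) (by omega), mul_comm]
        · refine Finset.sum_congr rfl fun k hk => ?_
          rw [Finset.mem_range] at hk
          rw [ih (l - k) (by omega), ih (k + 1) (by omega)]
      ext n
      · rw [hatMinus_f_succ, G, G, ih l (by omega)]
        exact (hatPlus_h_succ b a l n).symm
      · exact G n
      · rw [hatMinus_h_succ, G, G, ih l (by omega)]
        exact (hatPlus_f_succ b a l n).symm

theorem coeffMinus_eq (a b : ℤ → ℂ) (c : ℕ → ℂ) (l : ℕ) :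
    coeffMinus a b c l = ⟨(coeffPlus b a c l).h, (coeffPlus b a c l).g, (coeffPlus b a c l).f⟩ := by
  simp [coeffMinus, coeffPlus, withConstants, hatMinus_eq]

theorem levelBelow_coeffMinus_eq (a b : ℤ → ℂ) (c : ℕ → ℂ) (r : ℕ) :
    levelBelow (coeffMinus a b c) r = ⟨(levelBelow (coeffPlus b a c) r).h,
      (levelBelow (coeffPlus b a c) r).g, (levelBelow (coeffPlus b a c) r).f⟩ := by
  cases r <;> simp [levelBelow, coeffMinus_eq]

theorem localPoly_coeffPlus_g (c : ℕ → ℂ) (r : ℕ) :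
    LocalPoly 2 fun a b n => (coeffPlus a b c r).g n - c r / 2 := by
  convert LocalPoly.sum (Finset.range (r + 1)) fun k _ =>
    (localPoly_hatPlus k).2.1.const_mul (c (r - k)) using 4
  simp [coeffPlus, withConstants, mul_sub, div_eq_mul_inv]

theorem localPoly_levelBelow_f (c : ℕ → ℂ) (r : ℕ) :
    LocalPoly 2 fun a b n => (levelBelow (coeffPlus a b c) r).f n
      + ∑ k ∈ Finset.range r, c (r - 1 - k) * a (n + (k + 1)) := by
  cases r with
  | zero => simpa [levelBelow] using LocalPoly.zero 2
  | succ r =>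
    convert LocalPoly.sum (Finset.range (r + 1)) fun k _ =>
      (localPoly_hatPlus k).1.const_mul (c (r - k)) using 4
    simp [levelBelow, coeffPlus, withConstants, mul_add, Finset.sum_add_distrib]

theorem localPoly_levelBelow_h (c : ℕ → ℂ) (r : ℕ) :
    LocalPoly 2 fun a b n => (levelBelow (coeffPlus a b c) r).h n
      - ∑ k ∈ Finset.range r, c (r - 1 - k) * b (n - k) := by
  cases r with
  | zero => simpa [levelBelow] using LocalPoly.zero 2
  | succ r =>
    convert LocalPoly.sum (Finset.range (r + 1)) fun k _ =>
      (localPoly_hatPlus k).2.2.const_mul (c (r - k)) using 4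
    simp [levelBelow, coeffPlus, withConstants, mul_sub]

/-! ### The vector field -/

/-- The right-hand side of the equation for `α`, solved for `α_t`. By the symmetry between the two
signs, `β_t` is minus the same expression with `a, b` and `r₋, r₊` exchanged. -/
noncomputable def velocity (rm rp : ℕ) (cm cp : ℕ → ℂ) (a b : ℤ → ℂ) (n : ℤ) : ℂ :=
  Complex.I * (a n * ((coeffPlus a b cp rp).g n + (coeffMinus a b cm rm).g (n - 1))
    - (levelBelow (coeffPlus a b cp) rp).f n + (levelBelow (coeffMinus a b cm) rm).f (n - 1))

theorem eq_fst_iff (rm rp : ℕ) (cm cp : ℕ → ℂ) (a b : ℤ → ℂ) (n : ℤ) (z : ℂ) :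
    -Complex.I * z - a n * ((coeffPlus a b cp rp).g n + (coeffMinus a b cm rm).g (n - 1))
      + (levelBelow (coeffPlus a b cp) rp).f n - (levelBelow (coeffMinus a b cm) rm).f (n - 1) = 0
      ↔ z = velocity rm rp cm cp a b n := by
  unfold velocity
  constructor <;> intro h
  · linear_combination Complex.I * h + z * Complex.I_sq
  · rw [h]
    linear_combination (-(a n * ((coeffPlus a b cp rp).g n + (coeffMinus a b cm rm).g (n - 1))
      - (levelBelow (coeffPlus a b cp) rp).f n
      + (levelBelow (coeffMinus a b cm) rm).f (n - 1))) * Complex.I_sq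

theorem eq_snd_iff (rm rp : ℕ) (cm cp : ℕ → ℂ) (a b : ℤ → ℂ) (n : ℤ) (z : ℂ) :
    -Complex.I * z + b n * ((coeffPlus a b cp rp).g (n - 1) + (coeffMinus a b cm rm).g n)
      - (levelBelow (coeffMinus a b cm) rm).h n + (levelBelow (coeffPlus a b cp) rp).h (n - 1) = 0
      ↔ z = -velocity rp rm cp cm b a n := by
  rw [← neg_eq_iff_eq_neg, ← eq_fst_iff]
  simp only [coeffMinus_eq, levelBelow_coeffMinus_eq]
  rw [← neg_eq_zero]
  ring_nf

/-- Up to terms of order two, the vector field is `i c_r a` plus a combination of differences of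
shifts of `a`: the condition on the summation constants removes the remaining multiple of `a`. -/
theorem localPoly_velocity (rm rp : ℕ) (cm cp : ℕ → ℂ)
    (hc : (∑ j ∈ Finset.range rp, cp j) + (∑ j ∈ Finset.range rm, cm j) = 0) :
    LocalPoly 2 fun a b n => velocity rm rp cm cp a b n
      - Complex.I * topConstant rm rp cm cp * a n
      - Complex.I * ((∑ k ∈ Finset.range rp, cp (rp - 1 - k) * (a (n + (k + 1)) - a n))
        + ∑ k ∈ Finset.range rm, cm (rm - 1 - k) * (a (n + -(k + 1)) - a n)) := by
  have hg := (localPoly_coeffPlus_g cp rp).add ((localPoly_coeffPlus_g cm rm).swap.shift (-1))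
  have hag : LocalPoly 2 _ := ((LocalPoly.fst 0).mul hg).weaken (by omega)
  have hf := localPoly_levelBelow_f cp rp
  have hh := (localPoly_levelBelow_h cm rm).swap.shift (-1)
  convert ((hag.sub hf).add hh).const_mul Complex.I using 4
  rename_i a b n
  have h1 : ∑ k ∈ Finset.range rp, cp (rp - 1 - k) = ∑ j ∈ Finset.range rp, cp j :=
    Finset.sum_range_reflect _ _
  have h2 : ∑ k ∈ Finset.range rm, cm (rm - 1 - k) = ∑ j ∈ Finset.range rm, cm j :=
    Finset.sum_range_reflect _ _
  have h3 : ∀ k : ℕ, n + -((k : ℤ) + 1) = n + -1 - k := fun k => by ring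
  simp only [velocity, coeffMinus_eq, levelBelow_coeffMinus_eq, topConstant, mul_sub,
    Finset.sum_sub_distrib, ← Finset.sum_mul, h1, h2, h3, add_zero, sub_eq_add_neg n 1]
  linear_combination Complex.I * a n * hc

theorem localPoly_velocity_zero (rm rp : ℕ) (cm cp : ℕ → ℂ) :
    LocalPoly 0 (velocity rm rp cm cp) := by
  have hg := ((localPoly_coeffPlus_g cp rp).weaken (Nat.zero_le 2)).add
    (.const (cp rp / 2))
  have hg' := (((localPoly_coeffPlus_g cm rm).weaken (Nat.zero_le 2)).add
    (.const (cm rm / 2))).swap.shift (-1)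
  have hf := ((localPoly_levelBelow_f cp rp).weaken (Nat.zero_le 2)).sub
    (LocalPoly.sum (Finset.range rp) fun k _ =>
      ((LocalPoly.fst (k + 1)).const_mul (cp (rp - 1 - k))).weaken (Nat.zero_le 1))
  have hh := (((localPoly_levelBelow_h cm rm).weaken (Nat.zero_le 2)).add
    (LocalPoly.sum (Finset.range rm) fun k _ =>
      ((LocalPoly.snd (-k)).const_mul (cm (rm - 1 - k))).weaken (Nat.zero_le 1))).swap.shift (-1)
  have hag := ((LocalPoly.fst 0).mul (hg.add hg')).weaken (Nat.zero_le _)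
  convert ((hag.sub hf).add hh).const_mul Complex.I using 4
  rename_i a b n
  simp [velocity, coeffMinus_eq, levelBelow_coeffMinus_eq, sub_eq_add_neg]

/-- On sequences whose squares and whose differences are dominated by a slowly varying sequence `Q`,
the vector field differs from `i c_r a` by a multiple of `Q`. -/
theorem exists_norm_velocity_sub_le (rm rp : ℕ) (cm cp : ℕ → ℂ)
    (hc : (∑ j ∈ Finset.range rp, cp j) + (∑ j ∈ Finset.range rm, cm j) = 0)
    {ρ : ℝ} (hρ : 1 ≤ ρ) (B : ℝ) :
    ∃ C, 0 ≤ C ∧ ∀ (a b : ℤ → ℂ) (Q : ℤ → ℝ), SlowlyVarying ρ Q → (∀ n, ‖a n‖ ≤ B) →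
      (∀ n, ‖b n‖ ≤ B) → (∀ n, ‖a n‖ ^ 2 ≤ Q n) → (∀ n, ‖b n‖ ^ 2 ≤ Q n) →
      (∀ n, ‖a (n + 1) - a n‖ ≤ Q n) →
      ∀ n, ‖velocity rm rp cm cp a b n - Complex.I * topConstant rm rp cm cp * a n‖ ≤ C * Q n := by
  obtain ⟨C, hC, h⟩ := (localPoly_velocity rm rp cm cp hc).exists_norm_le_pow
    (zero_le_one.trans hρ) B
  have hj : ∀ j : ℤ, 0 ≤ (j.natAbs : ℝ) * ρ ^ j.natAbs := fun j => by positivity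
  set S : ℝ := (∑ k ∈ Finset.range rp, ‖cp (rp - 1 - k)‖
      * (((k + 1 : ℤ).natAbs : ℝ) * ρ ^ (k + 1 : ℤ).natAbs))
    + ∑ k ∈ Finset.range rm, ‖cm (rm - 1 - k)‖
      * (((-(k + 1) : ℤ).natAbs : ℝ) * ρ ^ (-(k + 1) : ℤ).natAbs) with hS
  refine ⟨C + S, by positivity, fun a b Q hQ ha hb ha2 hb2 hd n => ?_⟩
  have hQ0 : ∀ n, 0 ≤ Q n := fun n => (norm_nonneg _).trans (hd n)
  have hB : 0 ≤ B := (norm_nonneg _).trans (ha 0)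
  -- The minimum with `B` makes the majorant `√Q` bounded independently of `Q`.
  have h1 := h a b (fun n => min B √(Q n)) (hQ.min_sqrt hρ hB) (fun n => min_le_left _ _)
    (fun n => le_min (ha n) (Real.le_sqrt_of_sq_le (ha2 n)))
    (fun n => le_min (hb n) (Real.le_sqrt_of_sq_le (hb2 n))) n
  have h2 : min B √(Q n) ^ 2 ≤ Q n := by
    calc min B √(Q n) ^ 2 ≤ √(Q n) ^ 2 := by
          gcongr
          exact min_le_right _ _
      _ = Q n := Real.sq_sqrt (hQ0 n)
  have h3 : ‖Complex.I * ((∑ k ∈ Finset.range rp, cp (rp - 1 - k) * (a (n + (k + 1)) - a n))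
      + ∑ k ∈ Finset.range rm, cm (rm - 1 - k) * (a (n + -(k + 1)) - a n))‖ ≤ S * Q n := by
    rw [norm_mul, Complex.norm_I, one_mul, hS, add_mul, Finset.sum_mul, Finset.sum_mul]
    refine norm_add_le_of_le (norm_sum_le_of_le _ fun k _ => ?_)
      (norm_sum_le_of_le _ fun k _ => ?_)
    all_goals
      rw [norm_mul, mul_assoc]
      exact mul_le_mul_of_nonneg_left (hQ.norm_shift_sub_le hρ hd _ n) (norm_nonneg _)
  have h4 := norm_add_le_of_le (h1.trans (mul_le_mul_of_nonneg_left h2 hC)) h3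
  rw [sub_add_cancel, ← add_mul] at h4
  exact h4

/-! ### A comparison principle for infinite systems -/

/-- One-sided form of Gronwall's inequality below, for times in `[0, S]`. The a priori bound `M` is
improved to `3 * A` by iterating in the norm `sup |u| e^{-2Kt}`, in which one integration gains a
factor `1 / 2`. -/
theorem norm_le_of_linear_growth_forward {ι F : Type*} [NormedAddCommGroup F] [NormedSpace ℝ F]
    {u u' : ι → ℝ → F} {e : ι → ℝ} (he : ∀ i, 0 ≤ e i) {S M A K : ℝ} (hA : 0 ≤ A) (hK : 0 < K)
    (hd : ∀ t ∈ Set.Icc 0 S, ∀ i, HasDerivAt (u i) (u' i t) t)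
    (hM : ∀ t ∈ Set.Icc 0 S, ∀ i, ‖u i t‖ ≤ M * e i)
    (h0 : ∀ i, ‖u i 0‖ ≤ A * e i)
    (hg : ∀ t ∈ Set.Icc 0 S, ∀ μ, 0 ≤ μ → (∀ i, ‖u i t‖ ≤ μ * e i) →
      ∀ i, ‖u' i t‖ ≤ K * (A + μ) * e i) :
    ∀ t ∈ Set.Icc 0 S, ∀ i, ‖u i t‖ ≤ 3 * A * Real.exp (2 * K * t) * e i := by
  have step : ∀ μ, 0 ≤ μ →
      (∀ t ∈ Set.Icc 0 S, ∀ i, ‖u i t‖ ≤ μ * Real.exp (2 * K * t) * e i) →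
      ∀ t ∈ Set.Icc 0 S, ∀ i, ‖u i t‖ ≤ (3 * A + μ) / 2 * Real.exp (2 * K * t) * e i := by
    intro μ hμ h t ht i
    have hexp : ∀ s : ℝ, 0 ≤ s → 1 ≤ Real.exp (2 * K * s) := fun s hs =>
      Real.one_le_exp (by positivity)
    have key : ‖u i t‖ ≤ (A + (A + μ) / 2 * (Real.exp (2 * K * t) - 1)) * e i := by
      refine image_norm_le_of_norm_deriv_right_le_deriv_boundary
        (f := u i) (f' := u' i) (a := 0) (b := S)
        (B := fun t => (A + (A + μ) / 2 * (Real.exp (2 * K * t) - 1)) * e i)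
        (B' := fun t => (A + μ) * K * Real.exp (2 * K * t) * e i)
        (fun s hs => (hd s hs i).continuousAt.continuousWithinAt)
        (fun s hs => (hd s ⟨hs.1, hs.2.le⟩ i).hasDerivWithinAt) (by simpa using h0 i)
        (fun s => ?_) (fun s hs => ?_) ht
      · have h1 : HasDerivAt (fun t : ℝ => Real.exp (2 * K * t))
            (Real.exp (2 * K * s) * (2 * K * 1)) s := ((hasDerivAt_id s).const_mul (2 * K)).exp
        have h2 := (((h1.sub_const 1).const_mul ((A + μ) / 2)).const_add A).mul_const (e i)
        exact h2.congr_deriv (by ring)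
      · have hs' : s ∈ Set.Icc 0 S := ⟨hs.1, hs.2.le⟩
        refine (hg s hs' _ (by positivity) (h s hs') i).trans ?_
        refine mul_le_mul_of_nonneg_right ?_ (he i)
        nlinarith [mul_nonneg (mul_nonneg hK.le hA) (sub_nonneg.2 (hexp s hs.1))]
    refine key.trans (mul_le_mul_of_nonneg_right ?_ (he i))
    nlinarith [mul_nonneg hA (sub_nonneg.2 (hexp t ht.1))]
  -- `3 * A` is the fixed point of `μ ↦ (3 * A + μ) / 2`, approached geometrically from above.
  have iter : ∀ k : ℕ, ∀ t ∈ Set.Icc 0 S, ∀ i,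
      ‖u i t‖ ≤ (3 * A + |M| / 2 ^ k) * Real.exp (2 * K * t) * e i := by
    intro k
    induction k with
    | zero =>
      intro t ht i
      refine (hM t ht i).trans (mul_le_mul_of_nonneg_right ?_ (he i))
      have h1 : 1 ≤ Real.exp (2 * K * t) := Real.one_le_exp (by have := ht.1; positivity)
      have h2 : 0 ≤ 3 * A + |M| := by positivity
      simp only [pow_zero, div_one]
      nlinarith [le_abs_self M, mul_nonneg h2 (sub_nonneg.2 h1)]
    | succ k ih =>
      have h1 := step _ (by positivity) ih
      have h2 : (3 * A + (3 * A + |M| / 2 ^ k)) / 2 = 3 * A + |M| / 2 ^ (k + 1) := by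
        rw [pow_succ]
        field_simp
        ring
      rwa [h2] at h1
  intro t ht i
  have h1 : Filter.Tendsto (fun k : ℕ => |M| / 2 ^ k) Filter.atTop (nhds 0) := by
    simpa [div_eq_mul_inv] using
      (tendsto_pow_atTop_nhds_zero_of_lt_one (by norm_num) one_half_lt_one).const_mul |M|
  have h2 := ((h1.const_add (3 * A)).mul_const (Real.exp (2 * K * t))).mul_const (e i)
  rw [add_zero] at h2
  exact ge_of_tendsto' h2 fun k => iter k t ht i

/-- Gronwall's inequality for an infinite system with a weight `e`: if the derivatives grow at most
linearly in the weighted supremum norm, a solution of finite weighted norm is bounded in terms of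
its initial values alone. -/
theorem norm_le_of_linear_growth {ι F : Type*} [NormedAddCommGroup F] [NormedSpace ℝ F]
    {u u' : ι → ℝ → F} {e : ι → ℝ} (he : ∀ i, 0 ≤ e i) {S M A K : ℝ} (hA : 0 ≤ A) (hK : 0 < K)
    (hd : ∀ t, |t| ≤ S → ∀ i, HasDerivAt (u i) (u' i t) t)
    (hM : ∀ t, |t| ≤ S → ∀ i, ‖u i t‖ ≤ M * e i)
    (h0 : ∀ i, ‖u i 0‖ ≤ A * e i)
    (hg : ∀ t, |t| ≤ S → ∀ μ, 0 ≤ μ → (∀ i, ‖u i t‖ ≤ μ * e i) →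
      ∀ i, ‖u' i t‖ ≤ K * (A + μ) * e i) (t : ℝ) (ht : |t| ≤ S) (i : ι) :
    ‖u i t‖ ≤ 3 * A * Real.exp (2 * K * |t|) * e i := by
  have habs : ∀ s ∈ Set.Icc 0 S, |s| ≤ S := fun s hs => by rw [abs_of_nonneg hs.1]; exact hs.2
  obtain h | h := le_total 0 t
  · rw [abs_of_nonneg h] at ht ⊢
    exact norm_le_of_linear_growth_forward he hA hK (fun s hs => hd s (habs s hs))
      (fun s hs => hM s (habs s hs)) h0 (fun s hs => hg s (habs s hs)) t ⟨h, ht⟩ i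
  · rw [abs_of_nonpos h] at ht ⊢
    have habs' : ∀ s ∈ Set.Icc 0 S, |-s| ≤ S := fun s hs => by rw [abs_neg]; exact habs s hs
    have := norm_le_of_linear_growth_forward (u := fun i s => u i (-s))
      (u' := fun i s => -u' i (-s)) he hA hK
      (fun s hs i => by
        simpa [Function.comp_def] using (hd (-s) (habs' s hs) i).scomp s (hasDerivAt_neg s))
      (fun s hs => hM (-s) (habs' s hs)) (by simpa using h0)
      (fun s hs => by simpa using hg (-s) (habs' s hs)) (-t) ⟨by linarith, ht⟩ i
    simpa using this

/-! ### Uniqueness -/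

section

variable {rm rp : ℕ} {cm cp : ℕ → ℂ} {T : ℝ} {α β α' β' : ℝ → ℤ → ℂ}

theorem IsSolution.hasDerivAt_fst (h : IsSolution rm rp cm cp T α β) {t : ℝ}
    (ht : t ∈ Set.Ioo (-T) T) (n : ℤ) :
    HasDerivAt (fun s => α s n) (velocity rm rp cm cp (α t) (β t) n) t := by
  rw [← (eq_fst_iff _ _ _ _ _ _ _ _).1 (h.eq_fst t ht n)]
  exact (h.diff_fst t ht n).hasDerivAt

theorem IsSolution.hasDerivAt_snd (h : IsSolution rm rp cm cp T α β) {t : ℝ}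
    (ht : t ∈ Set.Ioo (-T) T) (n : ℤ) :
    HasDerivAt (fun s => β s n) (-velocity rp rm cp cm (β t) (α t) n) t := by
  rw [← (eq_snd_iff _ _ _ _ _ _ _ _).1 (h.eq_snd t ht n)]
  exact (h.diff_snd t ht n).hasDerivAt

theorem IsSolution.of_hasDerivAt
    (hb : ∀ S < T, ∃ C : ℝ, ∀ t : ℝ, |t| ≤ S → ∀ n : ℤ, ‖α t n‖ ≤ C ∧ ‖β t n‖ ≤ C)
    (hα : ∀ t ∈ Set.Ioo (-T) T, ∀ n,
      HasDerivAt (fun s => α s n) (velocity rm rp cm cp (α t) (β t) n) t)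
    (hβ : ∀ t ∈ Set.Ioo (-T) T, ∀ n,
      HasDerivAt (fun s => β s n) (-velocity rp rm cp cm (β t) (α t) n) t) :
    IsSolution rm rp cm cp T α β where
  bounded := hb
  diff_fst t ht n := (hα t ht n).differentiableAt
  diff_snd t ht n := (hβ t ht n).differentiableAt
  eq_fst t ht n := (eq_fst_iff _ _ _ _ _ _ _ _).2 (hα t ht n).deriv
  eq_snd t ht n := (eq_snd_iff _ _ _ _ _ _ _ _).2 (hβ t ht n).deriv

theorem IsSolution.eq_of_initial_eq (h : IsSolution rm rp cm cp T α β)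
    (h' : IsSolution rm rp cm cp T α' β') (h0 : ∀ n, α' 0 n = α 0 n) (h0' : ∀ n, β' 0 n = β 0 n)
    {t : ℝ} (ht : t ∈ Set.Ioo (-T) T) : α' t = α t ∧ β' t = β t := by
  have htT : |t| < T := abs_lt.2 ht
  have hIoo : ∀ s, |s| ≤ |t| → s ∈ Set.Ioo (-T) T := fun s hs => abs_lt.1 (hs.trans_lt htT)
  obtain ⟨B₁, hB₁⟩ := h.bounded |t| htT
  obtain ⟨B₂, hB₂⟩ := h'.bounded |t| htT
  set B := max B₁ B₂
  have hα : ∀ s, |s| ≤ |t| → ∀ n, ‖α s n‖ ≤ B := fun s hs n => le_max_of_le_left (hB₁ s hs n).1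
  have hβ : ∀ s, |s| ≤ |t| → ∀ n, ‖β s n‖ ≤ B := fun s hs n => le_max_of_le_left (hB₁ s hs n).2
  have hα' : ∀ s, |s| ≤ |t| → ∀ n, ‖α' s n‖ ≤ B := fun s hs n =>
    le_max_of_le_right (hB₂ s hs n).1
  have hβ' : ∀ s, |s| ≤ |t| → ∀ n, ‖β' s n‖ ≤ B := fun s hs n =>
    le_max_of_le_right (hB₂ s hs n).2
  obtain ⟨K₁, hK₁, hL₁⟩ := (localPoly_velocity_zero rm rp cm cp).exists_norm_sub_le B
  obtain ⟨K₂, hK₂, hL₂⟩ := (localPoly_velocity_zero rp rm cp cm).exists_norm_sub_le B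
  have key := norm_le_of_linear_growth (ι := ℤ) (F := ℂ × ℂ)
    (u := fun n s => (α' s n - α s n, β' s n - β s n))
    (u' := fun n s => (velocity rm rp cm cp (α' s) (β' s) n - velocity rm rp cm cp (α s) (β s) n,
      -velocity rp rm cp cm (β' s) (α' s) n - -velocity rp rm cp cm (β s) (α s) n))
    (e := fun _ => 1) (S := |t|) (M := B + B) (A := 0) (K := max K₁ K₂ + 1)
    (fun _ => zero_le_one) le_rfl (by positivity)
    (fun s hs n => ((h'.hasDerivAt_fst (hIoo s hs) n).sub
      (h.hasDerivAt_fst (hIoo s hs) n)).prodMk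
        ((h'.hasDerivAt_snd (hIoo s hs) n).sub (h.hasDerivAt_snd (hIoo s hs) n)))
    (fun s hs n => by
      rw [mul_one, Prod.norm_def]
      exact max_le (norm_sub_le_of_le (hα' s hs n) (hα s hs n))
        (norm_sub_le_of_le (hβ' s hs n) (hβ s hs n)))
    (fun n => by simp [h0, h0'])
    (fun s hs μ hμ hu n => by
      have h1 : ∀ n, ‖α' s n - α s n‖ ≤ μ := fun n => by
        simpa using (norm_fst_le _).trans (hu n)
      have h2 : ∀ n, ‖β' s n - β s n‖ ≤ μ := fun n => by
        simpa using (norm_snd_le _).trans (hu n)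
      rw [mul_one, zero_add, Prod.norm_def]
      refine max_le ((hL₁ _ _ _ _ μ (hα' s hs) (hβ' s hs) (hα s hs) (hβ s hs) h1 h2 n).trans ?_) ?_
      · exact mul_le_mul_of_nonneg_right (by linarith [le_max_left K₁ K₂]) hμ
      · rw [neg_sub_neg, norm_sub_rev]
        refine (hL₂ _ _ _ _ μ (hβ' s hs) (hα' s hs) (hβ s hs) (hα s hs) h2 h1 n).trans ?_
        exact mul_le_mul_of_nonneg_right (by linarith [le_max_right K₁ K₂]) hμ)
    t le_rfl
  simp only [mul_zero, zero_mul, norm_le_zero_iff, Prod.mk_eq_zero, sub_eq_zero] at key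
  exact ⟨funext fun n => (key n).1, funext fun n => (key n).2⟩

end

/-! ### Local existence -/

/-- The space of pairs of bounded sequences, on which the system is an ordinary differential
equation with a locally Lipschitz right-hand side. -/
abbrev PairSpace : Type := BoundedContinuousFunction ℤ ℂ × BoundedContinuousFunction ℤ ℂ

theorem PairSpace.norm_fst_apply_le (x : PairSpace) (n : ℤ) : ‖x.1 n‖ ≤ ‖x‖ :=
  (x.1.norm_coe_le_norm n).trans (norm_fst_le x)

theorem PairSpace.norm_snd_apply_le (x : PairSpace) (n : ℤ) : ‖x.2 n‖ ≤ ‖x‖ :=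
  (x.2.norm_coe_le_norm n).trans (norm_snd_le x)

theorem LocalPoly.exists_norm_apply_le {d : ℕ} {Φ : (ℤ → ℂ) → (ℤ → ℂ) → ℤ → ℂ}
    (h : LocalPoly d Φ) (x : PairSpace) : ∃ C, ∀ n, ‖Φ x.1 x.2 n‖ ≤ C := by
  obtain ⟨C, -, hC⟩ := h.exists_norm_le ‖x‖
  exact ⟨C, hC _ _ x.norm_fst_apply_le x.norm_snd_apply_le⟩

/-- The map of bounded sequences induced by a polynomial in shifts. -/
noncomputable def LocalPoly.toBounded {d : ℕ} {Φ : (ℤ → ℂ) → (ℤ → ℂ) → ℤ → ℂ}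
    (h : LocalPoly d Φ) (x : PairSpace) : BoundedContinuousFunction ℤ ℂ :=
  .ofNormedAddCommGroupDiscrete (Φ x.1 x.2) (h.exists_norm_apply_le x).choose
    (h.exists_norm_apply_le x).choose_spec

theorem LocalPoly.exists_lipschitzOnWith {d : ℕ} {Φ : (ℤ → ℂ) → (ℤ → ℂ) → ℤ → ℂ}
    (h : LocalPoly d Φ) (x₀ : PairSpace) (R : ℝ) :
    ∃ K, LipschitzOnWith K h.toBounded (Metric.closedBall x₀ R) := by
  obtain ⟨K, hK, hL⟩ := h.exists_norm_sub_le (‖x₀‖ + R)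
  refine ⟨K.toNNReal, LipschitzOnWith.of_dist_le_mul fun x hx y hy => ?_⟩
  have hn : ∀ x ∈ Metric.closedBall x₀ R, ‖x‖ ≤ ‖x₀‖ + R := fun x hx => by
    rw [mem_closedBall_iff_norm] at hx
    linarith [norm_le_norm_add_norm_sub' x x₀]
  rw [Real.coe_toNNReal K hK, BoundedContinuousFunction.dist_le (by positivity)]
  intro n
  rw [dist_eq_norm, dist_eq_norm]
  exact hL x.1 x.2 y.1 y.2 ‖x - y‖ (fun n => (x.norm_fst_apply_le n).trans (hn x hx))
    (fun n => (x.norm_snd_apply_le n).trans (hn x hx))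
    (fun n => (y.norm_fst_apply_le n).trans (hn y hy))
    (fun n => (y.norm_snd_apply_le n).trans (hn y hy))
    (fun n => PairSpace.norm_fst_apply_le (x - y) n)
    (fun n => PairSpace.norm_snd_apply_le (x - y) n) n

theorem exists_isSolution (rm rp : ℕ) (cm cp : ℕ → ℂ) {a b : ℤ → ℂ} (ha : IsBoundedSeq a)
    (hb : IsBoundedSeq b) :
    ∃ T : ℝ, 0 < T ∧ ∃ α β : ℝ → ℤ → ℂ, IsSolution rm rp cm cp T α β ∧
      (∀ n, α 0 n = a n) ∧ (∀ n, β 0 n = b n) := by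
  obtain ⟨Ca, hCa⟩ := ha
  obtain ⟨Cb, hCb⟩ := hb
  let x₀ : PairSpace := 
    (.ofNormedAddCommGroupDiscrete a Ca hCa, .ofNormedAddCommGroupDiscrete b Cb hCb)
  have hV₁ := localPoly_velocity_zero rm rp cm cp
  have hV₂ := (localPoly_velocity_zero rp rm cp cm).swap.neg
  let V : PairSpace → PairSpace := fun x => (hV₁.toBounded x, hV₂.toBounded x)
  obtain ⟨K₁, hK₁⟩ := hV₁.exists_lipschitzOnWith x₀ (1 : NNReal)
  obtain ⟨K₂, hK₂⟩ := hV₂.exists_lipschitzOnWith x₀ (1 : NNReal)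
  have hV : LipschitzOnWith (max K₁ K₂) V (Metric.closedBall x₀ (1 : NNReal)) := hK₁.prodMk hK₂
  set L : NNReal := ‖V x₀‖₊ + max K₁ K₂ with hL
  have hb : ∀ x ∈ Metric.closedBall x₀ (1 : NNReal), ‖V x‖ ≤ L := by
    intro x hx
    have h1 := hV.dist_le_mul x hx x₀ (Metric.mem_closedBall_self zero_le_one)
    have h2 := norm_le_norm_add_norm_sub' (V x) (V x₀)
    rw [← dist_eq_norm] at h2
    have h3 : ((max K₁ K₂ : NNReal) : ℝ) * dist x x₀ ≤ (max K₁ K₂ : NNReal) * 1 :=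
      mul_le_mul_of_nonneg_left (by simpa using hx) (NNReal.coe_nonneg _)
    rw [hL, NNReal.coe_add, coe_nnnorm]
    linarith
  have hL1 : (0 : ℝ) < L + 1 := by positivity
  -- The speed is at most `L` on the unit ball, so the curve stays in it up to time `1 / (L + 1)`.
  set T : ℝ := 1 / (L + 1) with hT
  have hT0 : 0 < T := by positivity
  have hpl : IsPicardLindelof (fun _ => V) (tmin := -T) (tmax := T)
      ⟨0, by simp [hT0.le]⟩ x₀ 1 0 L (max K₁ K₂) := by
    refine .of_time_independent hb hV ?_
    simp only [sub_zero, zero_sub, neg_neg, max_self, NNReal.coe_one, NNReal.coe_zero]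
    rw [hT, mul_one_div, div_le_one hL1]
    linarith
  obtain ⟨γ, hγ0, hγ⟩ := hpl.exists_eq_forall_mem_Icc_hasDerivWithinAt₀
  have hd : ∀ t ∈ Set.Ioo (-T) T, HasDerivAt γ (V (γ t)) t := fun t ht =>
    (hγ t ⟨ht.1.le, ht.2.le⟩).hasDerivAt (Icc_mem_nhds ht.1 ht.2)
  refine ⟨T, hT0, fun t => (γ t).1, fun t => (γ t).2, .of_hasDerivAt ?_ ?_ ?_, ?_, ?_⟩
  · intro S hS
    have hcont : ContinuousOn γ (Set.Icc (-S) S) := fun t ht =>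
      (hd t ⟨by linarith [ht.1], ht.2.trans_lt hS⟩).continuousAt.continuousWithinAt
    obtain ⟨C, hC⟩ := isCompact_Icc.exists_bound_of_continuousOn hcont
    exact ⟨C, fun t ht n => ⟨((γ t).norm_fst_apply_le n).trans (hC t (abs_le.1 ht)),
      ((γ t).norm_snd_apply_le n).trans (hC t (abs_le.1 ht))⟩⟩
  · intro t ht n
    exact ((BoundedContinuousFunction.evalCLM ℝ n).comp
      (ContinuousLinearMap.fst ℝ _ _)).hasFDerivAt.comp_hasDerivAt t (hd t ht)
  · intro t ht n
    exact ((BoundedContinuousFunction.evalCLM ℝ n).comp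
      (ContinuousLinearMap.snd ℝ _ _)).hasFDerivAt.comp_hasDerivAt t (hd t ht)
  · intro n
    change (γ 0).1 n = a n
    rw [show γ 0 = x₀ from hγ0]
    rfl
  · intro n
    change (γ 0).2 n = b n
    rw [show γ 0 = x₀ from hγ0]
    rfl

/-! ### Weighted sequence spaces -/

/-- The nonnegative sequence `x` belongs to the space in which the perturbation lives: `w xᵖ` is
summable if `p < ∞`, and `w² x` is bounded if `p = ∞`. -/
structure WeightedMem (w : ℤ → ℝ) (p : ℝ≥0∞) (x : ℤ → ℝ) : Prop where
  nonneg : ∀ n, 0 ≤ x n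
  tsum_lt_top : p ≠ ∞ → ∑' n, ENNReal.ofReal (w n * x n ^ p.toReal) < ∞
  bounded : p = ∞ → ∃ C, ∀ n, w n ^ 2 * x n ≤ C

variable {w : ℤ → ℝ} {p : ℝ≥0∞} {x y : ℤ → ℝ}

theorem one_le_toReal (hp : 1 ≤ p) (hp' : p ≠ ∞) : 1 ≤ p.toReal := by
  rw [← ENNReal.toReal_one]
  exact ENNReal.toReal_mono hp' hp

theorem WeightedMem.mono (h : WeightedMem w p x) (hw : ∀ n, 0 ≤ w n) {C : ℝ} (hC : 0 ≤ C)
    (hy : ∀ n, 0 ≤ y n) (hyx : ∀ n, y n ≤ C * x n) : WeightedMem w p y where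
  nonneg := hy
  tsum_lt_top hp := by
    have h1 : ∀ n, ENNReal.ofReal (w n * y n ^ p.toReal)
        ≤ ENNReal.ofReal (C ^ p.toReal) * ENNReal.ofReal (w n * x n ^ p.toReal) := fun n => by
      rw [← ENNReal.ofReal_mul (by positivity)]
      refine ENNReal.ofReal_le_ofReal ?_
      rw [mul_left_comm, ← Real.mul_rpow hC (h.nonneg n)]
      exact mul_le_mul_of_nonneg_left
        (Real.rpow_le_rpow (hy n) (hyx n) ENNReal.toReal_nonneg) (hw n)
    refine (ENNReal.tsum_le_tsum h1).trans_lt ?_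
    rw [ENNReal.tsum_mul_left]
    exact ENNReal.mul_lt_top ENNReal.ofReal_lt_top (h.tsum_lt_top hp)
  bounded hp := by
    obtain ⟨B, hB⟩ := h.bounded hp
    refine ⟨C * B, fun n => ?_⟩
    calc w n ^ 2 * y n ≤ w n ^ 2 * (C * x n) :=
          mul_le_mul_of_nonneg_left (hyx n) (sq_nonneg _)
      _ = C * (w n ^ 2 * x n) := by ring
      _ ≤ C * B := mul_le_mul_of_nonneg_left (hB n) hC

theorem WeightedMem.add (h : WeightedMem w p x) (h' : WeightedMem w p y) (hw : ∀ n, 0 ≤ w n)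
    (hp1 : 1 ≤ p) : WeightedMem w p fun n => x n + y n where
  nonneg n := add_nonneg (h.nonneg n) (h'.nonneg n)
  tsum_lt_top hp := by
    have h1 : ∀ n, ENNReal.ofReal (w n * (x n + y n) ^ p.toReal)
        ≤ ENNReal.ofReal (2 ^ (p.toReal - 1)) * (ENNReal.ofReal (w n * x n ^ p.toReal)
          + ENNReal.ofReal (w n * y n ^ p.toReal)) := fun n => by
      have hx := Real.rpow_nonneg (h.nonneg n) p.toReal
      have hy := Real.rpow_nonneg (h'.nonneg n) p.toReal
      rw [← ENNReal.ofReal_add (mul_nonneg (hw n) hx) (mul_nonneg (hw n) hy),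
        ← ENNReal.ofReal_mul (by positivity)]
      refine ENNReal.ofReal_le_ofReal ?_
      rw [← mul_add, mul_left_comm]
      have h2 := NNReal.rpow_add_le_mul_rpow_add_rpow ⟨x n, h.nonneg n⟩ ⟨y n, h'.nonneg n⟩
        (one_le_toReal hp1 hp)
      exact mul_le_mul_of_nonneg_left (by exact_mod_cast h2) (hw n)
    refine (ENNReal.tsum_le_tsum h1).trans_lt ?_
    rw [ENNReal.tsum_mul_left, ENNReal.tsum_add]
    exact ENNReal.mul_lt_top ENNReal.ofReal_lt_top
      (ENNReal.add_lt_top.2 ⟨h.tsum_lt_top hp, h'.tsum_lt_top hp⟩)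
  bounded hp := by
    obtain ⟨B, hB⟩ := h.bounded hp
    obtain ⟨B', hB'⟩ := h'.bounded hp
    exact ⟨B + B', fun n => by rw [mul_add]; exact add_le_add (hB n) (hB' n)⟩

theorem wnorm_lt_top_iff (hp1 : 1 ≤ p) (hp : p ≠ ∞) (a b : ℤ → ℂ) :
    wnorm w p a b < ∞ ↔
      ∑' n, ENNReal.ofReal (w n * (‖a n‖ ^ p.toReal + ‖b n‖ ^ p.toReal)) < ∞ := by
  rw [wnorm, if_neg hp, ENNReal.rpow_lt_top_iff_of_pos]
  have := one_le_toReal hp1 hp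
  positivity

theorem wnorm_top_lt_top_iff (a b : ℤ → ℂ) :
    wnorm w ∞ a b < ∞ ↔ ∃ C, ∀ n, w n * (‖a n‖ + ‖b n‖) ≤ C := by
  rw [wnorm, if_pos rfl]
  constructor
  · intro h
    exact ⟨_, fun n => (ENNReal.ofReal_le_iff_le_toReal h.ne).1
      (le_iSup (fun n => ENNReal.ofReal (w n * (‖a n‖ + ‖b n‖))) n)⟩
  · rintro ⟨C, hC⟩
    exact (iSup_le fun n => ENNReal.ofReal_le_ofReal (hC n)).trans_lt ENNReal.ofReal_lt_top

theorem wnorm_swap (w : ℤ → ℝ) (p : ℝ≥0∞) (a b : ℤ → ℂ) : wnorm w p a b = wnorm w p b a := by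
  simp only [wnorm, add_comm]

theorem WeightedMem.of_wnorm (hw : ∀ n, 0 ≤ w n) (hp1 : 1 ≤ p) {a b : ℤ → ℂ}
    (h : p ≠ ∞ → wnorm w p a b < ∞) (h' : p = ∞ → wnorm (fun n => w n ^ 2) ∞ a b < ∞) :
    WeightedMem w p fun n => ‖a n‖ where
  nonneg n := norm_nonneg _
  tsum_lt_top hp := by
    refine (ENNReal.tsum_le_tsum fun n => ENNReal.ofReal_le_ofReal ?_).trans_lt
      ((wnorm_lt_top_iff hp1 hp a b).1 (h hp))
    exact mul_le_mul_of_nonneg_left (le_add_of_nonneg_right (by positivity)) (hw n)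
  bounded hp := by
    obtain ⟨C, hC⟩ := (wnorm_top_lt_top_iff a b).1 (h' hp)
    refine ⟨C, fun n => le_trans ?_ (hC n)⟩
    exact mul_le_mul_of_nonneg_left (le_add_of_nonneg_right (norm_nonneg _)) (sq_nonneg _)

theorem WeightedMem.sq_of_wnorm (hw : ∀ n, 0 ≤ w n) (hp1 : 1 ≤ p) {a b : ℤ → ℂ}
    (h : p ≠ ∞ → wnorm w (2 * p) a b < ∞) (h' : p = ∞ → wnorm w ∞ a b < ∞) :
    WeightedMem w p fun n => ‖a n‖ ^ 2 where
  nonneg n := by positivity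
  tsum_lt_top hp := by
    have hp2 : 1 ≤ 2 * p := hp1.trans (le_mul_of_one_le_left' one_le_two)
    have hp2' : 2 * p ≠ ∞ := ENNReal.mul_ne_top ENNReal.ofNat_ne_top hp
    refine (ENNReal.tsum_le_tsum fun n => ENNReal.ofReal_le_ofReal ?_).trans_lt
      ((wnorm_lt_top_iff hp2 hp2' a b).1 (h hp))
    refine mul_le_mul_of_nonneg_left ?_ (hw n)
    rw [ENNReal.toReal_mul, ENNReal.toReal_ofNat, Real.rpow_mul (norm_nonneg _), Real.rpow_ofNat]
    exact le_add_of_nonneg_right (by positivity)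
  bounded hp := by
    obtain ⟨C, hC⟩ := (wnorm_top_lt_top_iff a b).1 (h' hp)
    refine ⟨C ^ 2, fun n => ?_⟩
    rw [← mul_pow]
    refine pow_le_pow_left₀ (mul_nonneg (hw n) (norm_nonneg _)) (le_trans ?_ (hC n)) 2
    exact mul_le_mul_of_nonneg_left (le_add_of_nonneg_right (norm_nonneg _)) (hw n)

theorem WeightedMem.wnorm_lt_top (hw : ∀ n, 0 ≤ w n) (hp1 : 1 ≤ p) (hx : WeightedMem w p x)
    {a b : ℤ → ℂ} (ha : ∀ n, ‖a n‖ ≤ x n) (hb : ∀ n, ‖b n‖ ≤ x n) :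
    (p ≠ ∞ → wnorm w p a b < ∞) ∧ (p = ∞ → wnorm (fun n => w n ^ 2) ∞ a b < ∞) := by
  refine ⟨fun hp => ?_, fun hp => ?_⟩
  · rw [wnorm_lt_top_iff hp1 hp]
    have h1 : ∀ n, ENNReal.ofReal (w n * (‖a n‖ ^ p.toReal + ‖b n‖ ^ p.toReal))
        ≤ 2 * ENNReal.ofReal (w n * x n ^ p.toReal) := fun n => by
      rw [← ENNReal.ofReal_ofNat 2, ← ENNReal.ofReal_mul zero_le_two]
      refine ENNReal.ofReal_le_ofReal ?_
      rw [mul_left_comm, two_mul]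
      refine mul_le_mul_of_nonneg_left (add_le_add ?_ ?_) (hw n)
      · exact Real.rpow_le_rpow (norm_nonneg _) (ha n) ENNReal.toReal_nonneg
      · exact Real.rpow_le_rpow (norm_nonneg _) (hb n) ENNReal.toReal_nonneg
    refine (ENNReal.tsum_le_tsum h1).trans_lt ?_
    rw [ENNReal.tsum_mul_left]
    exact ENNReal.mul_lt_top ENNReal.ofNat_lt_top (hx.tsum_lt_top hp)
  · obtain ⟨C, hC⟩ := hx.bounded hp
    rw [wnorm_top_lt_top_iff]
    refine ⟨2 * C, fun n => ?_⟩
    nlinarith [hC n, mul_le_mul_of_nonneg_left (add_le_add (ha n) (hb n)) (sq_nonneg (w n))]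

theorem summable_pow_natAbs {r : ℝ} (h0 : 0 ≤ r) (h1 : r < 1) :
    Summable fun m : ℤ => r ^ m.natAbs := by
  refine .of_nat_of_neg ?_ ?_ <;> simpa using summable_geometric_of_lt_one h0 h1

/-- Every bounded element of the weighted space has a slowly varying majorant in the same space,
namely `E(n) = sup_m θ^|m| D(n + m)` for a `θ` small enough to beat the growth of the weight. -/
theorem WeightedMem.exists_slowlyVarying (hw : ∀ n, 1 ≤ w n) {κ : ℝ} (hκ : 1 ≤ κ)
    (hκw : SlowlyVarying κ w) (hp1 : 1 ≤ p) {D : ℤ → ℝ} (hD : WeightedMem w p D) {B : ℝ}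
    (hB : ∀ n, D n ≤ B) :
    ∃ ρ, 1 ≤ ρ ∧ ∃ E : ℤ → ℝ, SlowlyVarying ρ E ∧ (∀ n, D n ≤ E n) ∧ WeightedMem w p E := by
  have hκ0 : 0 < κ := by linarith
  have hw0 : ∀ n, 0 < w n := fun n => by linarith [hw n]
  -- Summability for `p < ∞` needs `θ κ < 1`; boundedness for `p = ∞` needs `θ κ² ≤ 1`.
  set θ : ℝ := (2 * κ ^ 2)⁻¹ with hθ
  have hθ0 : 0 < θ := by positivity
  have hθκ2 : κ ^ 2 * θ ≤ 1 := by
    rw [hθ]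
    field_simp
    norm_num
  have hθκ : θ * κ ≤ 1 / 2 := by
    rw [hθ]
    field_simp
    linarith
  have hθ1 : θ ≤ 1 := by nlinarith
  have hterm : ∀ n m : ℤ, θ ^ m.natAbs * D (n + m) ≤ B := fun n m =>
    (mul_le_of_le_one_left (hD.nonneg _) (pow_le_one₀ hθ0.le hθ1)).trans (hB _)
  have hbdd : ∀ n, BddAbove (Set.range fun m : ℤ => θ ^ m.natAbs * D (n + m)) := fun n =>
    ⟨B, by rintro _ ⟨m, rfl⟩; exact hterm n m⟩
  set E : ℤ → ℝ := fun n => ⨆ m : ℤ, θ ^ m.natAbs * D (n + m) with hE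
  have hle : ∀ n m : ℤ, θ ^ m.natAbs * D (n + m) ≤ E n := fun n m => le_ciSup (hbdd n) m
  have hDE : ∀ n, D n ≤ E n := fun n => by simpa using hle n 0
  have hE0 : ∀ n, 0 ≤ E n := fun n => (hD.nonneg n).trans (hDE n)
  have hstep : ∀ n j : ℤ, j.natAbs = 1 → E (n + j) ≤ θ⁻¹ * E n := by
    intro n j hj
    refine ciSup_le fun m => ?_
    rw [le_inv_mul_iff₀ hθ0, ← mul_assoc, ← pow_succ', add_assoc]
    refine le_trans (mul_le_mul_of_nonneg_right ?_ (hD.nonneg _)) (hle n (j + m))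
    exact pow_le_pow_of_le_one hθ0.le hθ1 (by omega)
  have hwm : ∀ n m : ℤ, w n ≤ κ ^ m.natAbs * w (n + m) := fun n m => by
    simpa using hκw.shift_le hκ0.le (-m) (n + m)
  refine ⟨θ⁻¹, (one_le_inv₀ hθ0).2 hθ1, E, fun n => ⟨hstep n 1 rfl, ?_⟩, hDE, hE0, ?_, ?_⟩
  · simpa using hstep (n + 1) (-1) rfl
  · intro hp
    have hp1' := one_le_toReal hp1 hp
    have hp0 : 0 < p.toReal := by linarith
    have key : ∀ n, ENNReal.ofReal (w n * E n ^ p.toReal) ≤ ∑' m : ℤ,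
        ENNReal.ofReal ((θ * κ) ^ m.natAbs)
          * ENNReal.ofReal (w (n + m) * D (n + m) ^ p.toReal) := by
      intro n
      set R : ℝ≥0∞ := ∑' m : ℤ, ENNReal.ofReal ((θ * κ) ^ m.natAbs)
          * ENNReal.ofReal (w (n + m) * D (n + m) ^ p.toReal) with hR
      by_cases hRt : R = ∞
      · rw [hRt]
        exact le_top
      rw [ENNReal.ofReal_le_iff_le_toReal hRt, mul_comm, ← le_div_iff₀ (hw0 n),
        ← Real.le_rpow_inv_iff_of_pos (hE0 n) (div_nonneg ENNReal.toReal_nonneg (hw0 n).le) hp0]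
      refine ciSup_le fun m => ?_
      have hθm : 0 ≤ θ ^ m.natAbs := by positivity
      have hDp := Real.rpow_nonneg (hD.nonneg (n + m)) p.toReal
      rw [Real.le_rpow_inv_iff_of_pos (mul_nonneg hθm (hD.nonneg _))
        (div_nonneg ENNReal.toReal_nonneg (hw0 n).le) hp0, le_div_iff₀ (hw0 n),
        ← ENNReal.ofReal_le_iff_le_toReal hRt]
      refine le_trans ?_ (ENNReal.le_tsum m)
      rw [← ENNReal.ofReal_mul (by positivity)]
      refine ENNReal.ofReal_le_ofReal ?_
      rw [Real.mul_rpow hθm (hD.nonneg _)]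
      have h1 : (θ ^ m.natAbs) ^ p.toReal ≤ θ ^ m.natAbs := by
        simpa using Real.rpow_le_rpow_of_exponent_ge' hθm (pow_le_one₀ hθ0.le hθ1) zero_le_one hp1'
      calc (θ ^ m.natAbs) ^ p.toReal * D (n + m) ^ p.toReal * w n
          ≤ θ ^ m.natAbs * D (n + m) ^ p.toReal * (κ ^ m.natAbs * w (n + m)) :=
            mul_le_mul (mul_le_mul_of_nonneg_right h1 hDp) (hwm n m) (hw0 n).le
              (mul_nonneg hθm hDp)
        _ = (θ * κ) ^ m.natAbs * (w (n + m) * D (n + m) ^ p.toReal) := by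
            rw [mul_pow]
            ring
    refine (ENNReal.tsum_le_tsum key).trans_lt ?_
    rw [ENNReal.tsum_comm]
    have hshift : ∀ m : ℤ, ∑' n : ℤ, ENNReal.ofReal (w (n + m) * D (n + m) ^ p.toReal)
        = ∑' n : ℤ, ENNReal.ofReal (w n * D n ^ p.toReal) := fun m =>
      (Equiv.addRight m).tsum_eq fun n => ENNReal.ofReal (w n * D n ^ p.toReal)
    simp only [ENNReal.tsum_mul_left, hshift, ENNReal.tsum_mul_right]
    refine ENNReal.mul_lt_top ?_ (hD.tsum_lt_top hp)
    exact (summable_pow_natAbs (by positivity) (by linarith)).tsum_ofReal_lt_top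
  · intro hp
    obtain ⟨C, hC⟩ := hD.bounded hp
    refine ⟨C, fun n => ?_⟩
    rw [mul_comm, ← le_div_iff₀ (pow_pos (hw0 n) 2)]
    refine ciSup_le fun m => ?_
    rw [le_div_iff₀ (pow_pos (hw0 n) 2)]
    have h1 : w n ^ 2 ≤ (κ ^ m.natAbs * w (n + m)) ^ 2 :=
      pow_le_pow_left₀ (hw0 n).le (hwm n m) 2
    have h2 : (κ ^ 2 * θ) ^ m.natAbs ≤ 1 := pow_le_one₀ (by positivity) hθκ2
    calc θ ^ m.natAbs * D (n + m) * w n ^ 2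
        ≤ θ ^ m.natAbs * D (n + m) * (κ ^ m.natAbs * w (n + m)) ^ 2 :=
          mul_le_mul_of_nonneg_left h1 (mul_nonneg (by positivity) (hD.nonneg _))
      _ = (κ ^ 2 * θ) ^ m.natAbs * (w (n + m) ^ 2 * D (n + m)) := by
          rw [mul_pow, mul_pow, ← pow_mul, ← pow_mul, mul_comm 2]
          ring
      _ ≤ w (n + m) ^ 2 * D (n + m) :=
          mul_le_of_le_one_left (mul_nonneg (sq_nonneg _) (hD.nonneg _)) h2
      _ ≤ C := hC _

theorem exists_slowlyVarying_weight (hw : ∀ n, 1 ≤ w n)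
    (hw' : BddAbove (Set.range fun n : ℤ => |w (n + 1) / w n| + |w n / w (n + 1)|)) :
    ∃ κ, 1 ≤ κ ∧ SlowlyVarying κ w := by
  obtain ⟨κ, hκ⟩ := hw'
  have hw0 : ∀ n, 0 < w n := fun n => by linarith [hw n]
  have h : ∀ n, |w (n + 1) / w n| + |w n / w (n + 1)| ≤ max κ 1 := fun n =>
    le_max_of_le_left (hκ ⟨n, rfl⟩)
  refine ⟨max κ 1, le_max_right _ _, fun n => ⟨?_, ?_⟩⟩
  · rw [← div_le_iff₀ (hw0 n)]
    linarith [h n, le_abs_self (w (n + 1) / w n), abs_nonneg (w n / w (n + 1))]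
  · rw [← div_le_iff₀ (hw0 _)]
    linarith [h n, le_abs_self (w n / w (n + 1)), abs_nonneg (w (n + 1) / w n)]

/-! ### Propagation of the asymptotics -/

/-- If `a` and `b` are, up to bounded factors, perturbations `α₀ + x` and `β₀ + y` with `x` and `y`
at most `μ e`, then the vector field differs from `i c_r a` by at most a multiple of `(1 + μ) e`:
squares of `α₀`, `β₀` and differences of `α₀` are controlled by `e`, and `x²` is controlled by `|x|`
because `x` is bounded. The constant is independent of `e`. -/
theorem exists_norm_velocity_sub_le_of_perturbation (rm rp : ℕ) (cm cp : ℕ → ℂ)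
    (hc : (∑ j ∈ Finset.range rp, cp j) + (∑ j ∈ Finset.range rm, cm j) = 0)
    {ρ Λ M : ℝ} (hρ : 1 ≤ ρ) (hΛ : 0 ≤ Λ) (hM : 0 ≤ M) (B : ℝ) :
    ∃ K, 0 ≤ K ∧ ∀ (a b α₀ β₀ x y : ℤ → ℂ) (u v : ℂ) (e : ℤ → ℝ) (μ : ℝ), SlowlyVarying ρ e →
      0 ≤ μ → ‖u‖ ≤ Λ → ‖v‖ ≤ Λ → (∀ n, a n = u * (α₀ n + x n)) → (∀ n, b n = v * (β₀ n + y n)) →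
      (∀ n, ‖a n‖ ≤ B) → (∀ n, ‖b n‖ ≤ B) → (∀ n, ‖x n‖ ≤ M) → (∀ n, ‖y n‖ ≤ M) →
      (∀ n, ‖α₀ n‖ ^ 2 ≤ e n) → (∀ n, ‖β₀ n‖ ^ 2 ≤ e n) → (∀ n, ‖α₀ n - α₀ (n + 1)‖ ≤ e n) →
      (∀ n, ‖x n‖ ≤ μ * e n) → (∀ n, ‖y n‖ ≤ μ * e n) →
      ∀ n, ‖velocity rm rp cm cp a b n - Complex.I * topConstant rm rp cm cp * a n‖
        ≤ K * (1 + μ) * e n := by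
  obtain ⟨C, hC, h⟩ := exists_norm_velocity_sub_le rm rp cm cp hc hρ B
  have hρ0 : 0 ≤ ρ := by linarith
  set K : ℝ := Λ ^ 2 * (2 + 2 * M) + Λ * (1 + 2 * ρ) with hK
  have hK0 : 0 ≤ K := by positivity
  refine ⟨C * K, by positivity, ?_⟩
  intro a b α₀ β₀ x y u v e μ he hμ hu hv ha hb haB hbB hxM hyM hα hβ hd hx hy n
  have he0 : ∀ n, 0 ≤ e n := fun n => (norm_nonneg _).trans (hd n)
  have hsq : ∀ (z s : ℤ → ℂ) (l : ℂ), ‖l‖ ≤ Λ → (∀ n, ‖z n‖ ^ 2 ≤ e n) → (∀ n, ‖s n‖ ≤ M) →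
      (∀ n, ‖s n‖ ≤ μ * e n) → ∀ n, ‖l * (z n + s n)‖ ^ 2 ≤ K * (1 + μ) * e n := by
    intro z s l hl hz hsM hs n
    have h1 : ‖z n + s n‖ ^ 2 ≤ 2 * e n + 2 * (M * (μ * e n)) := by
      have h2 : ‖z n + s n‖ ^ 2 ≤ (‖z n‖ + ‖s n‖) ^ 2 :=
        pow_le_pow_left₀ (norm_nonneg _) (norm_add_le _ _) 2
      have h3 : ‖s n‖ ^ 2 ≤ M * (μ * e n) := by
        rw [sq]
        exact mul_le_mul (hsM n) (hs n) (norm_nonneg _) hM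
      nlinarith [hz n, sq_nonneg (‖z n‖ - ‖s n‖)]
    rw [norm_mul, mul_pow]
    calc ‖l‖ ^ 2 * ‖z n + s n‖ ^ 2 ≤ Λ ^ 2 * (2 * e n + 2 * (M * (μ * e n))) :=
          mul_le_mul (pow_le_pow_left₀ (norm_nonneg _) hl 2) h1 (sq_nonneg _) (sq_nonneg _)
      _ ≤ Λ ^ 2 * ((2 + 2 * M) * (1 + μ) * e n) := by
          refine mul_le_mul_of_nonneg_left ?_ (sq_nonneg _)
          have h4 := mul_nonneg hμ (he0 n)
          have h5 := mul_nonneg hM (he0 n)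
          nlinarith
      _ = Λ ^ 2 * (2 + 2 * M) * ((1 + μ) * e n) := by ring
      _ ≤ K * ((1 + μ) * e n) := by
          refine mul_le_mul_of_nonneg_right ?_ (mul_nonneg (by linarith) (he0 n))
          rw [hK]
          exact le_add_of_nonneg_right (by positivity)
      _ = K * (1 + μ) * e n := by ring
  have hdiff : ∀ n, ‖a (n + 1) - a n‖ ≤ K * (1 + μ) * e n := by
    intro n
    have h1 : ‖α₀ (n + 1) - α₀ n + (x (n + 1) - x n)‖ ≤ e n + (μ * (ρ * e n) + μ * e n) := by
      refine norm_add_le_of_le ?_ (norm_sub_le_of_le ?_ (hx n))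
      · rw [norm_sub_rev]
        exact hd n
      · exact (hx _).trans (mul_le_mul_of_nonneg_left (he n).1 hμ)
    rw [ha, ha, ← mul_sub, add_sub_add_comm, norm_mul]
    calc ‖u‖ * ‖α₀ (n + 1) - α₀ n + (x (n + 1) - x n)‖
        ≤ Λ * (e n + (μ * (ρ * e n) + μ * e n)) := mul_le_mul hu h1 (norm_nonneg _) hΛ
      _ ≤ Λ * ((1 + 2 * ρ) * (1 + μ) * e n) := by
          refine mul_le_mul_of_nonneg_left ?_ hΛ
          have h4 := mul_nonneg hμ (he0 n)
          have h5 := mul_nonneg hρ0 (he0 n)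
          have h6 := mul_nonneg hρ0 h4
          nlinarith
      _ = Λ * (1 + 2 * ρ) * ((1 + μ) * e n) := by ring
      _ ≤ K * ((1 + μ) * e n) := by
          refine mul_le_mul_of_nonneg_right ?_ (mul_nonneg (by linarith) (he0 n))
          rw [hK]
          exact le_add_of_nonneg_left (by positivity)
      _ = K * (1 + μ) * e n := by ring
  have h1 := h a b (fun n => K * (1 + μ) * e n) (he.const_mul (by positivity)) haB hbB
    (fun n => by rw [ha]; exact hsq α₀ x u hu hα hxM hx n)
    (fun n => by rw [hb]; exact hsq β₀ y v hv hβ hyM hy n) hdiff n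
  calc _ ≤ C * (K * (1 + μ) * e n) := h1
    _ = C * K * (1 + μ) * e n := by ring

theorem hasDerivAt_exp_mul (z : ℂ) (t : ℝ) :
    HasDerivAt (fun s : ℝ => Complex.exp (z * s)) (Complex.exp (z * t) * z) t := by
  simpa using ((hasDerivAt_id t).ofReal_comp.const_mul z).cexp

theorem norm_exp_mul_le (z : ℂ) {t S : ℝ} (ht : |t| ≤ S) :
    ‖Complex.exp (z * t)‖ ≤ Real.exp (‖z‖ * S) := by
  refine (Complex.norm_exp_le_exp_norm _).trans (Real.exp_le_exp.2 ?_)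
  rw [norm_mul, Complex.norm_real, Real.norm_eq_abs]
  exact mul_le_mul_of_nonneg_left ht (norm_nonneg _)

/-- The gauge-transformed perturbation of a solution stays dominated by any slowly varying majorant
of the initial perturbation, of the differences of the background `(α₀, β₀)` and of its squares.
The majorant need not be positive, so the comparison is made with `E + ε`, whose constants do not
depend on `ε`. -/
theorem IsSolution.exists_perturbation_le {rm rp : ℕ} {cm cp : ℕ → ℂ}
    (hc : (∑ j ∈ Finset.range rp, cp j) + (∑ j ∈ Finset.range rm, cm j) = 0)
    {T : ℝ} {α β : ℝ → ℤ → ℂ} (h : IsSolution rm rp cm cp T α β) {α₀ β₀ : ℤ → ℂ}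
    (hα₀ : IsBoundedSeq α₀) (hβ₀ : IsBoundedSeq β₀) {ρ : ℝ} (hρ : 1 ≤ ρ) {E : ℤ → ℝ}
    (hE : SlowlyVarying ρ E) (hα : ∀ n, ‖α₀ n‖ ^ 2 ≤ E n) (hβ : ∀ n, ‖β₀ n‖ ^ 2 ≤ E n)
    (hdα : ∀ n, ‖α₀ n - α₀ (n + 1)‖ ≤ E n) (hdβ : ∀ n, ‖β₀ n - β₀ (n + 1)‖ ≤ E n)
    (h0α : ∀ n, ‖α 0 n - α₀ n‖ ≤ E n) (h0β : ∀ n, ‖β 0 n - β₀ n‖ ≤ E n)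
    {t : ℝ} (ht : t ∈ Set.Ioo (-T) T) :
    ∃ C, 0 ≤ C ∧ ∀ n,
      ‖Complex.exp (-(Complex.I * topConstant rm rp cm cp) * t) * α t n - α₀ n‖ ≤ C * E n ∧
      ‖Complex.exp (Complex.I * topConstant rm rp cm cp * t) * β t n - β₀ n‖ ≤ C * E n := by
  set z : ℂ := Complex.I * topConstant rm rp cm cp with hz
  have hz' : Complex.I * topConstant rp rm cp cm = z := by
    rw [hz, topConstant, topConstant, add_comm]
  have htT : |t| < T := abs_lt.2 ht
  have hIoo : ∀ s, |s| ≤ |t| → s ∈ Set.Ioo (-T) T := fun s hs => abs_lt.1 (hs.trans_lt htT)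
  obtain ⟨B, hB⟩ := h.bounded |t| htT
  have hB0 : 0 ≤ B := (norm_nonneg _).trans (hB 0 (by simp) 0).1
  obtain ⟨A₁, hA₁⟩ := hα₀
  obtain ⟨A₂, hA₂⟩ := hβ₀
  set A := max A₁ A₂
  have hA : 0 ≤ A := (norm_nonneg _).trans ((hA₁ 0).trans (le_max_left _ _))
  set Λ := Real.exp (‖z‖ * |t|) with hΛdef
  have hΛ : 0 ≤ Λ := (Real.exp_pos _).le
  have hexp : ∀ s, |s| ≤ |t| → ‖Complex.exp (z * s)‖ ≤ Λ := fun s hs => norm_exp_mul_le z hs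
  have hexp' : ∀ s, |s| ≤ |t| → ‖Complex.exp (-z * s)‖ ≤ Λ := fun s hs => by
    simpa using norm_exp_mul_le (-z) hs
  have hinv : ∀ s : ℝ, Complex.exp (z * s) * Complex.exp (-z * s) = 1 := fun s => by
    rw [← Complex.exp_add, neg_mul, add_neg_cancel, Complex.exp_zero]
  set M := Λ * B + A
  have hM : 0 ≤ M := by positivity
  let x : ℝ → ℤ → ℂ := fun s n => Complex.exp (-z * s) * α s n - α₀ n
  let y : ℝ → ℤ → ℂ := fun s n => Complex.exp (z * s) * β s n - β₀ n
  have hxα : ∀ s n, α s n = Complex.exp (z * s) * (α₀ n + x s n) := fun s n => by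
    linear_combination -α s n * hinv s
  have hyβ : ∀ s n, β s n = Complex.exp (-z * s) * (β₀ n + y s n) := fun s n => by
    linear_combination -β s n * hinv s
  have hxM : ∀ s, |s| ≤ |t| → ∀ n, ‖x s n‖ ≤ M := fun s hs n => by
    refine norm_sub_le_of_le ?_ ((hA₁ n).trans (le_max_left _ _))
    rw [norm_mul]
    exact mul_le_mul (hexp' s hs) (hB s hs n).1 (norm_nonneg _) hΛ
  have hyM : ∀ s, |s| ≤ |t| → ∀ n, ‖y s n‖ ≤ M := fun s hs n => by
    refine norm_sub_le_of_le ?_ ((hA₂ n).trans (le_max_right _ _))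
    rw [norm_mul]
    exact mul_le_mul (hexp s hs) (hB s hs n).2 (norm_nonneg _) hΛ
  obtain ⟨K₁, hK₁, hV₁⟩ :=
    exists_norm_velocity_sub_le_of_perturbation rm rp cm cp hc hρ hΛ hM B
  obtain ⟨K₂, hK₂, hV₂⟩ :=
    exists_norm_velocity_sub_le_of_perturbation rp rm cp cm (by rw [add_comm]; exact hc) hρ hΛ hM B
  set K := Λ * max K₁ K₂ + 1
  have hE0 : ∀ n, 0 ≤ E n := fun n => (norm_nonneg _).trans (hdα n)
  have key : ∀ ε : ℝ, 0 < ε → ∀ n,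
      ‖(x t n, y t n)‖ ≤ 3 * 1 * Real.exp (2 * K * |t|) * (E n + ε) := by
    intro ε hε
    have hEε : ∀ n, E n ≤ E n + ε := fun n => by linarith
    have hEε0 : ∀ n, 0 ≤ E n + ε := fun n => (hE0 n).trans (hEε n)
    refine norm_le_of_linear_growth (ι := ℤ) (F := ℂ × ℂ) (u := fun n s => (x s n, y s n))
      (u' := fun n s => (Complex.exp (-z * s) * (velocity rm rp cm cp (α s) (β s) n - z * α s n),
        -(Complex.exp (z * s) * (velocity rp rm cp cm (β s) (α s) n - z * β s n))))
      (e := fun n => E n + ε) (S := |t|) (M := M / ε) (A := 1) (K := K)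
      hEε0 zero_le_one (by positivity) ?_ ?_ ?_ ?_ t le_rfl
    · intro s hs n
      refine HasDerivAt.prodMk ?_ ?_
      · exact (((hasDerivAt_exp_mul (-z) s).mul (h.hasDerivAt_fst (hIoo s hs) n)).sub_const
          (α₀ n)).congr_deriv (by ring)
      · exact (((hasDerivAt_exp_mul z s).mul (h.hasDerivAt_snd (hIoo s hs) n)).sub_const
          (β₀ n)).congr_deriv (by ring)
    · intro s hs n
      have h1 : M ≤ M / ε * (E n + ε) := by
        rw [mul_add, div_mul_cancel₀ _ hε.ne']
        exact le_add_of_nonneg_left (mul_nonneg (by positivity) (hE0 n))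
      exact (max_le (hxM s hs n) (hyM s hs n)).trans h1
    · intro n
      have h1 : ‖x 0 n‖ ≤ E n := by simpa [x] using h0α n
      have h2 : ‖y 0 n‖ ≤ E n := by simpa [y] using h0β n
      rw [one_mul]
      exact (max_le h1 h2).trans (hEε n)
    · intro s hs μ hμ hu n
      have hx : ∀ n, ‖x s n‖ ≤ μ * (E n + ε) := fun n => (norm_fst_le _).trans (hu n)
      have hy : ∀ n, ‖y s n‖ ≤ μ * (E n + ε) := fun n => (norm_snd_le _).trans (hu n)
      have hslow : SlowlyVarying ρ fun n => E n + ε := hE.add_const hρ hε.le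
      have h1 := hV₁ (α s) (β s) α₀ β₀ (x s) (y s) _ _ _ μ hslow hμ (hexp s hs) (hexp' s hs)
        (hxα s) (hyβ s) (fun n => (hB s hs n).1) (fun n => (hB s hs n).2) (hxM s hs) (hyM s hs)
        (fun n => (hα n).trans (hEε n)) (fun n => (hβ n).trans (hEε n))
        (fun n => (hdα n).trans (hEε n)) hx hy n
      have h2 := hV₂ (β s) (α s) β₀ α₀ (y s) (x s) _ _ _ μ hslow hμ (hexp' s hs) (hexp s hs)
        (hyβ s) (hxα s) (fun n => (hB s hs n).2) (fun n => (hB s hs n).1) (hyM s hs) (hxM s hs)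
        (fun n => (hβ n).trans (hEε n)) (fun n => (hα n).trans (hEε n))
        (fun n => (hdβ n).trans (hEε n)) hy hx n
      rw [hz'] at h2
      have hpos : 0 ≤ (1 + μ) * (E n + ε) := mul_nonneg (by linarith) (hEε0 n)
      have hfin : ∀ (l v : ℂ) (k : ℝ), ‖l‖ ≤ Λ → k ≤ max K₁ K₂ →
          ‖v‖ ≤ k * (1 + μ) * (E n + ε) → ‖l * v‖ ≤ K * (1 + μ) * (E n + ε) := by
        intro l v k hl hk hv
        rw [norm_mul]
        calc ‖l‖ * ‖v‖ ≤ Λ * (k * (1 + μ) * (E n + ε)) := mul_le_mul hl hv (norm_nonneg _) hΛ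
          _ = Λ * k * ((1 + μ) * (E n + ε)) := by ring
          _ ≤ K * ((1 + μ) * (E n + ε)) := by
              refine mul_le_mul_of_nonneg_right ?_ hpos
              exact (mul_le_mul_of_nonneg_left hk hΛ).trans (by simp [K])
          _ = K * (1 + μ) * (E n + ε) := by ring
      refine max_le (hfin _ _ _ (hexp' s hs) (le_max_left _ _) h1) ?_
      simp only [norm_neg]
      exact hfin _ _ _ (hexp s hs) (le_max_right _ _) h2
  have hlim : ∀ n, ‖(x t n, y t n)‖ ≤ 3 * 1 * Real.exp (2 * K * |t|) * E n := by
    intro n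
    refine le_of_forall_pos_le_add fun δ hδ => ?_
    have hC : 0 < 3 * 1 * Real.exp (2 * K * |t|) := by positivity
    have := key (δ / (3 * 1 * Real.exp (2 * K * |t|))) (by positivity) n
    rwa [mul_add, mul_div_cancel₀ _ hC.ne'] at this
  exact ⟨3 * 1 * Real.exp (2 * K * |t|), by positivity,
    fun n => ⟨(norm_fst_le _).trans (hlim n), (norm_snd_le _).trans (hlim n)⟩⟩

end AblowitzLadik

theorem theorem3p3
    (rm rp : ℕ) (hr : (rm, rp) ≠ (0, 0)) (cm cp : ℕ → ℂ)
    (hc : (∑ j ∈ Finset.range rp, cp j) + (∑ j ∈ Finset.range rm, cm j) = 0)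
    (w : ℤ → ℝ) (hw : ∀ n : ℤ, 1 ≤ w n)
    (hw' : BddAbove (Set.range fun n : ℤ => |w (n + 1) / w n| + |w n / w (n + 1)|))
    (p : ENNReal) (hp : 1 ≤ p)
    (α₀ β₀ a₀ b₀ : ℤ → ℂ)
    (hα₀ : AblowitzLadik.IsBoundedSeq α₀) (hβ₀ : AblowitzLadik.IsBoundedSeq β₀)
    (ha₀ : AblowitzLadik.IsBoundedSeq a₀) (hb₀ : AblowitzLadik.IsBoundedSeq b₀)
    (hfin : p ≠ ⊤ →
      AblowitzLadik.wnorm w (2 * p) α₀ β₀ < ⊤ ∧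
      AblowitzLadik.wnorm w p (fun n => α₀ n - α₀ (n + 1)) (fun n => β₀ n - β₀ (n + 1)) < ⊤ ∧
      AblowitzLadik.wnorm w p a₀ b₀ < ⊤)
    (hinf : p = ⊤ →
      AblowitzLadik.wnorm w ⊤ α₀ β₀ < ⊤ ∧
      AblowitzLadik.wnorm (fun n => w n ^ 2) ⊤
        (fun n => α₀ n - α₀ (n + 1)) (fun n => β₀ n - β₀ (n + 1)) < ⊤ ∧
      AblowitzLadik.wnorm (fun n => w n ^ 2) ⊤ a₀ b₀ < ⊤) :
    -- local existence of the solution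
    (∃ T : ℝ, 0 < T ∧ ∃ α β : ℝ → ℤ → ℂ, AblowitzLadik.IsSolution rm rp cm cp T α β ∧
      (∀ n, α 0 n = α₀ n + a₀ n) ∧ (∀ n, β 0 n = β₀ n + b₀ n)) ∧
    ∀ (T : ℝ) (α β : ℝ → ℤ → ℂ), 0 < T → AblowitzLadik.IsSolution rm rp cm cp T α β →
      (∀ n, α 0 n = α₀ n + a₀ n) → (∀ n, β 0 n = β₀ n + b₀ n) →
      -- uniqueness of the solution
      (∀ α' β' : ℝ → ℤ → ℂ, AblowitzLadik.IsSolution rm rp cm cp T α' β' →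
        (∀ n, α' 0 n = α₀ n + a₀ n) → (∀ n, β' 0 n = β₀ n + b₀ n) →
        ∀ t ∈ Set.Ioo (-T) T, α' t = α t ∧ β' t = β t) ∧
      -- form of the solution; the exponentials are `1` if `c_r = 0`
      (∀ t ∈ Set.Ioo (-T) T, ∃ a b : ℤ → ℂ,
        (∀ n, α t n =
          Complex.exp (Complex.I * AblowitzLadik.topConstant rm rp cm cp * t) * (α₀ n + a n)) ∧
        (∀ n, β t n =
          Complex.exp (-(Complex.I * AblowitzLadik.topConstant rm rp cm cp * t)) *
            (β₀ n + b n)) ∧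
        (p ≠ ⊤ → AblowitzLadik.wnorm w p a b < ⊤) ∧
        (p = ⊤ → AblowitzLadik.wnorm (fun n => w n ^ 2) ⊤ a b < ⊤)) := by
  open AblowitzLadik in
  have hsum : ∀ {x y : ℤ → ℂ}, IsBoundedSeq x → IsBoundedSeq y →
      IsBoundedSeq fun n => x n + y n := by
    rintro x y ⟨C, hC⟩ ⟨C', hC'⟩
    exact ⟨C + C', fun n => norm_add_le_of_le (hC n) (hC' n)⟩
  refine ⟨exists_isSolution rm rp cm cp (hsum hα₀ ha₀) (hsum hβ₀ hb₀), ?_⟩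
  intro T α β hT h h0 h0'
  refine ⟨fun α' β' h' h1 h1' t ht => h.eq_of_initial_eq h' (fun n => (h1 n).trans (h0 n).symm)
    (fun n => (h1' n).trans (h0' n).symm) ht, fun t ht => ?_⟩
  have hw0 : ∀ n, 0 ≤ w n := fun n => zero_le_one.trans (hw n)
  obtain ⟨κ, hκ, hκw⟩ := exists_slowlyVarying_weight hw hw'
  have m1 := WeightedMem.sq_of_wnorm hw0 hp (fun h => (hfin h).1) (fun h => (hinf h).1)
  have m2 := WeightedMem.sq_of_wnorm hw0 hp
    (fun h => (wnorm_swap _ _ _ _).trans_lt (hfin h).1)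
    (fun h => (wnorm_swap _ _ _ _).trans_lt (hinf h).1)
  have m3 := WeightedMem.of_wnorm hw0 hp (fun h => (hfin h).2.1) (fun h => (hinf h).2.1)
  have m4 := WeightedMem.of_wnorm hw0 hp
    (fun h => (wnorm_swap _ _ _ _).trans_lt (hfin h).2.1)
    (fun h => (wnorm_swap _ _ _ _).trans_lt (hinf h).2.1)
  have m5 := WeightedMem.of_wnorm hw0 hp (fun h => (hfin h).2.2) (fun h => (hinf h).2.2)
  have m6 := WeightedMem.of_wnorm hw0 hp
    (fun h => (wnorm_swap _ _ _ _).trans_lt (hfin h).2.2)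
    (fun h => (wnorm_swap _ _ _ _).trans_lt (hinf h).2.2)
  have hD := ((((m1.add m2 hw0 hp).add m3 hw0 hp).add m4 hw0 hp).add m5 hw0 hp).add m6 hw0 hp
  obtain ⟨A₁, hA₁⟩ := hα₀
  obtain ⟨A₂, hA₂⟩ := hβ₀
  obtain ⟨A₃, hA₃⟩ := ha₀
  obtain ⟨A₄, hA₄⟩ := hb₀
  obtain ⟨ρ, hρ, E, hE, hDE, hEmem⟩ := hD.exists_slowlyVarying hw hκ hκw hp
    (B := A₁ ^ 2 + A₂ ^ 2 + (A₁ + A₁) + (A₂ + A₂) + A₃ + A₄) fun n =>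
      add_le_add (add_le_add (add_le_add (add_le_add (add_le_add
        (pow_le_pow_left₀ (norm_nonneg _) (hA₁ n) 2) (pow_le_pow_left₀ (norm_nonneg _) (hA₂ n) 2))
        (norm_sub_le_of_le (hA₁ n) (hA₁ _))) (norm_sub_le_of_le (hA₂ n) (hA₂ _))) (hA₃ n)) (hA₄ n)
  obtain ⟨C, hC, hle⟩ := h.exists_perturbation_le hc ⟨A₁, hA₁⟩ ⟨A₂, hA₂⟩ hρ hE
    (fun n => by
      linarith [hDE n, m2.nonneg n, m3.nonneg n, m4.nonneg n, m5.nonneg n, m6.nonneg n])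
    (fun n => by
      linarith [hDE n, m1.nonneg n, m3.nonneg n, m4.nonneg n, m5.nonneg n, m6.nonneg n])
    (fun n => by
      linarith [hDE n, m1.nonneg n, m2.nonneg n, m4.nonneg n, m5.nonneg n, m6.nonneg n])
    (fun n => by
      linarith [hDE n, m1.nonneg n, m2.nonneg n, m3.nonneg n, m5.nonneg n, m6.nonneg n])
    (fun n => by
      rw [h0, add_sub_cancel_left]
      linarith [hDE n, m1.nonneg n, m2.nonneg n, m3.nonneg n, m4.nonneg n, m6.nonneg n])
    (fun n => by
      rw [h0', add_sub_cancel_left]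
      linarith [hDE n, m1.nonneg n, m2.nonneg n, m3.nonneg n, m4.nonneg n, m5.nonneg n]) ht
  have hCE : WeightedMem w p fun n => C * E n :=
    hEmem.mono hw0 hC (fun n => mul_nonneg hC (hEmem.nonneg n)) fun n => le_rfl
  refine ⟨_, _, fun n => ?_, fun n => ?_,
    hCE.wnorm_lt_top hw0 hp (fun n => (hle n).1) fun n => (hle n).2⟩
  · rw [add_sub_cancel, ← mul_assoc, ← Complex.exp_add, neg_mul, add_neg_cancel, Complex.exp_zero,
      one_mul]
  · rw [add_sub_cancel, ← mul_assoc, ← Complex.exp_add, neg_add_cancel, Complex.exp_zero, one_mul]
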